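/- **Setting.** Let $d\ge 1$, $k\ge 0$, $t_0<T$, $\Delta t_0:=T-t_0$, and write $|\cdot|$ for the Euclidean norm and $\|\cdot\|$ for the spectral (operator) norm. Let $N_t:\mathbb R^d\to\mathbb R^d$, $t\in[t_0,T]$, be such that $t\mapsto N_t(x)$ is in $L^\infty(t_0,T)$ for every $x$, $x\mapsto N_t(x)$ is $C^2$ for every $t$, and $\|DN_t(x)\|\le\Lambda_1$, $\|D^2N_t(x)\|\le\Lambda_2$ for all $(t,x)\in[t_0,T]\times\mathbb R^d$, where $\Lambda_1,\Lambda_2>0$. Let $B\in L^\infty((t_0,T)\times\mathbb R^d;\mathbb R^{d\times k})$ be such that, for every $t\in[t_0,T]$, $x\mapsto B(t,x)$ is $C^1$ with $\|D_xB(t,x)\|\le L_B$ for all $x$, where $L_B\ge0$. Let $\Phi_{s,t}$ be the flow of $N_t$: $t\mapsto\Phi_{s,t}(x)$ is the absolutely continuous solution on $[t_0,T]$ of $\dot\gamma=N_t(\gamma)$, $\gamma(s)=x$. Fix $x^0\in\mathbb R^d$; for $u\in L^\infty((t_0,T);\mathbb R^k)$ let $x_u$ be the solution of $\dot x=N_t(x)+B(t,x)u(t)$,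 $x(t_0)=x^0$. With $\tau_1=t_0$, $\tau_2=T$ and $i\in\{1,2\}$ put $$\mathcal N_i(u)=\int_{t_0}^{T}D\Phi_{t,\tau_i}(x_u(t))\,B(t,x_u(t))\,B(t,x_u(t))^\top D\Phi_{t,\tau_i}(x_u(t))^\top\,dt,\qquad W_i(T)=\mathcal N_i(0).$$ For $y\in\mathbb R^d$ the synthesis map is $$\mathcal S_i(u)(t)=B(t,x_u(t))^\top D\Phi_{t,\tau_i}(x_u(t))^\top\,\mathcal N_i(u)^\dagger\,y,$$ with $\dagger$ the Moore–Penrose pseudoinverse. For $C>0$ let $\mathcal F(C)=\{u\in L^\infty((t_0,T);\mathbb R^k):\lambda_{\min}(\mathcal N_i(u))\ge C^{-1}\}$, $\zeta(y)=C\|B\|_\infty e^{\Lambda_1\Delta t_0}|y|$ and $\mathcal F(y)=\{u\in\mathcal F(C):\|u\|_\infty\le\zeta(y)\}$. **Corollary.** Let $i\in\{1,2\}$ and $\theta\in(0,1)$, and assume that $W_2(T)$ is invertible. Then $\lambda_{\min}(W_i(T))>0$. Put $C:=(1+\theta)/\lambda_{\min}(W_i(T))$ in the definitions above. Then: 1.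 $\mathcal F(C)\ne\emptyset$. For every $y\in\mathbb R^d$, $\mathcal S_i$ maps $L^\infty((t_0,T);\mathbb R^k)$ into itself. 2. For every $y\in\mathbb R^d$, the map $u\mapsto\mathcal N_i(u)$ is Lipschitz on $\{u:\|u\|_\infty\le\zeta(y)\}$ (from $\|\cdot\|_\infty$ to $\|\cdot\|$). 3. Let $y_i\in\mathbb R^d$ and let $L_{\mathcal N_i}>0$ be any Lipschitz constant of $u\mapsto\mathcal N_i(u)$ on $\{u:\|u\|_\infty\le\zeta(y_i)\}$. If $$|y_i|\le\frac{\theta\,\lambda_{\min}(W_i(T))^2}{(1+\theta)^2\,L_{\mathcal N_i}\,\|B\|_\infty\,e^{\Lambda_1\Delta t_0}},$$ then $\mathcal S_i$, defined with $y=y_i$, satisfies $\mathcal S_i(\mathcal F(y_i))\subset\mathcal F(y_i)$; it has a fixed point in $\mathcal F(y_i)$; and every fixed point $u_i\in\mathcal F(y_i)$ of $\mathcal S_i$ satisfies $$\int_{t_0}^{T}|u_i(t)|^2\,dt\le\frac{1+\theta}{\lambda_{\min}(W_i(T))}\,|y_i|^2.$$ -/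

import Mathlib

open MeasureTheory Set
open scoped ENNReal NNReal

noncomputable section

/-- `ℝⁿ` with the Euclidean norm. -/
abbrev Euc (n : ℕ) : Type := EuclideanSpace ℝ (Fin n)

/-- Lebesgue measure on the time interval `(t₀, T)`. -/
abbrev timeMeasure (t₀ T : ℝ) : Measure ℝ := volume.restrict (Ioc t₀ T)

/-- The space of controls `L^∞((t₀, T); ℝᵏ)` (classes modulo almost everywhere equality, with the
essential supremum norm). -/
abbrev Control (k : ℕ) (t₀ T : ℝ) : Type := Lp (Euc k) ∞ (timeMeasure t₀ T)

/-- Standing assumptions on the drift `(t, x) ↦ N_t(x)` on `[t₀, T] × ℝᵈ`. -/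
structure DriftAssumption {d : ℕ} (N : ℝ → Euc d → Euc d) (t₀ T Λ₁ Λ₂ : ℝ) : Prop where
  lipschitz_pos : 0 < Λ₁
  second_pos : 0 < Λ₂
  memLp_time : ∀ x, MemLp (fun t => N t x) ∞ (timeMeasure t₀ T)
  contDiff : ∀ t ∈ Icc t₀ T, ContDiff ℝ 2 (N t)
  fderiv_le : ∀ t ∈ Icc t₀ T, ∀ x, ‖fderiv ℝ (N t) x‖ ≤ Λ₁
  second_fderiv_le : ∀ t ∈ Icc t₀ T, ∀ x, ‖fderiv ℝ (fderiv ℝ (N t)) x‖ ≤ Λ₂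

/-- Standing assumptions on the input matrix `B(t, x)`, seen as a linear map `ℝᵏ → ℝᵈ` with the
operator (spectral) norm: `B ∈ L^∞((t₀, T) × ℝᵈ)`, and `B(t, ·)` is `C¹` with differential bounded
by `LB`. -/
structure InputAssumption {d k : ℕ} (B : ℝ → Euc d → (Euc k →L[ℝ] Euc d)) (t₀ T LB : ℝ) :
    Prop where
  bound_nonneg : 0 ≤ LB
  memLp : MemLp (fun p : ℝ × Euc d => B p.1 p.2) ∞
    ((timeMeasure t₀ T).prod (volume : Measure (Euc d)))
  contDiff : ∀ t ∈ Icc t₀ T, ContDiff ℝ 1 (B t)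
  fderiv_le : ∀ t ∈ Icc t₀ T, ∀ x, ‖fderiv ℝ (B t) x‖ ≤ LB

/-- `‖B‖_∞`, the norm of `B` in `L^∞((t₀, T) × ℝᵈ)`. -/
def inputNorm {d k : ℕ} (B : ℝ → Euc d → (Euc k →L[ℝ] Euc d)) (t₀ T : ℝ) : ℝ :=
  (eLpNorm (fun p : ℝ × Euc d => B p.1 p.2) ∞
    ((timeMeasure t₀ T).prod (volume : Measure (Euc d)))).toReal

/-- `γ` is a Carathéodory (absolutely continuous) solution on `[t₀, T]` of `γ' = f(t, γ)` with
`γ(s) = x`, written in integral form. -/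
structure IsSolution {d : ℕ} (f : ℝ → Euc d → Euc d) (t₀ T s : ℝ) (x : Euc d)
    (γ : ℝ → Euc d) : Prop where
  continuousOn : ContinuousOn γ (Icc t₀ T)
  intervalIntegrable : IntervalIntegrable (fun r => f r (γ r)) volume t₀ T
  integral_eq : ∀ t ∈ Icc t₀ T, γ t = x + ∫ r in s..t, f r (γ r)

open Classical in
/-- The solution on `[t₀, T]` of `γ' = f(t, γ)`, `γ(s) = x` (unique on `[t₀, T]` for the equations
considered here; the constant `x` if there is none). -/
def solution {d : ℕ} (f : ℝ → Euc d → Euc d) (t₀ T s : ℝ) (x : Euc d) : ℝ → Euc d :=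
  if h : ∃ γ, IsSolution f t₀ T s x γ then h.choose else fun _ => x

/-- The flow `Φ_{s,t}(x)` of `N_t` on `[t₀, T]`: the value at time `t` of the solution that equals
`x` at time `s`. -/
def flow {d : ℕ} (N : ℝ → Euc d → Euc d) (t₀ T s t : ℝ) (x : Euc d) : Euc d :=
  solution N t₀ T s x t

/-- The trajectory `x_u` of `x' = N_t(x) + B(t, x) u(t)`, `x(t₀) = x⁰`. -/
def trajectory {d k : ℕ} (N : ℝ → Euc d → Euc d) (B : ℝ → Euc d → (Euc k →L[ℝ] Euc d))
    (t₀ T : ℝ) (x₀ : Euc d) (u : Control k t₀ T) : ℝ → Euc d :=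
  solution (fun t x => N t x + B t x (u t)) t₀ T t₀ x₀

/-- The kernel `DΦ_{t,τ}(x_u(t)) B(t, x_u(t))`. -/
def inputKernel {d k : ℕ} (N : ℝ → Euc d → Euc d) (B : ℝ → Euc d → (Euc k →L[ℝ] Euc d))
    (t₀ T τ : ℝ) (x₀ : Euc d) (u : Control k t₀ T) (t : ℝ) : Euc k →L[ℝ] Euc d :=
  (fderiv ℝ (flow N t₀ T t τ) (trajectory N B t₀ T x₀ u t)).comp
    (B t (trajectory N B t₀ T x₀ u t))

/-- The reference times `τ₁ = t₀` (index `0`) and `τ₂ = T` (index `1`). -/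
def refTime (t₀ T : ℝ) : Fin 2 → ℝ := ![t₀, T]

/-- The trajectory-dependent Gramian
`𝒩_i(u) = ∫ DΦ_{t,τᵢ}(x_u(t)) B(t,x_u(t)) B(t,x_u(t))ᵀ DΦ_{t,τᵢ}(x_u(t))ᵀ dt`
with reference time `τ = τᵢ`, as an operator on `ℝᵈ`. -/
def gramian {d k : ℕ} (N : ℝ → Euc d → Euc d) (B : ℝ → Euc d → (Euc k →L[ℝ] Euc d))
    (t₀ T τ : ℝ) (x₀ : Euc d) (u : Control k t₀ T) : Euc d →L[ℝ] Euc d :=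
  ∫ t in t₀..T, (inputKernel N B t₀ T τ x₀ u t).comp
    (ContinuousLinearMap.adjoint (inputKernel N B t₀ T τ x₀ u t))

/-- The smallest eigenvalue of a (symmetric) operator on `ℝᵈ`. -/
def lambdaMin {d : ℕ} (A : Euc d →L[ℝ] Euc d) : ℝ :=
  sInf {μ : ℝ | Module.End.HasEigenvalue (A : Euc d →ₗ[ℝ] Euc d) μ}

/-- `X` satisfies the four Penrose equations for `A`. -/
structure IsMoorePenrose {d : ℕ} (A X : Euc d →L[ℝ] Euc d) : Prop where
  mul_mul_self : A * X * A = A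
  mul_mul_inv : X * A * X = X
  selfAdjoint_left : IsSelfAdjoint (A * X)
  selfAdjoint_right : IsSelfAdjoint (X * A)

open Classical in
/-- The Moore–Penrose pseudoinverse of `A`, i.e. the unique solution of the Penrose equations. -/
def pinv {d : ℕ} (A : Euc d →L[ℝ] Euc d) : Euc d →L[ℝ] Euc d :=
  if h : ∃ X, IsMoorePenrose A X then h.choose else 0

/-- The function `t ↦ B(t,x_u(t))ᵀ DΦ_{t,τᵢ}(x_u(t))ᵀ 𝒩_i(u)^† y`. -/
def minControl {d k : ℕ} (N : ℝ → Euc d → Euc d) (B : ℝ → Euc d → (Euc k →L[ℝ] Euc d))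
    (t₀ T τ : ℝ) (x₀ y : Euc d) (u : Control k t₀ T) (t : ℝ) : Euc k :=
  ContinuousLinearMap.adjoint (inputKernel N B t₀ T τ x₀ u t)
    (pinv (gramian N B t₀ T τ x₀ u) y)

open Classical in
/-- The synthesis map `𝒮_i : L^∞ → L^∞`, sending `u` to the class of `minControl`. -/
def synthesis {d k : ℕ} (N : ℝ → Euc d → Euc d) (B : ℝ → Euc d → (Euc k →L[ℝ] Euc d))
    (t₀ T τ : ℝ) (x₀ y : Euc d) (u : Control k t₀ T) : Control k t₀ T :=
  if h : MemLp (minControl N B t₀ T τ x₀ y u) ∞ (timeMeasure t₀ T) then h.toLp _ else 0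

/-- The feasible coercivity class `ℱ(C)`. -/
def coercivityClass {d k : ℕ} (N : ℝ → Euc d → Euc d) (B : ℝ → Euc d → (Euc k →L[ℝ] Euc d))
    (t₀ T τ : ℝ) (x₀ : Euc d) (C : ℝ) : Set (Control k t₀ T) :=
  {u | C⁻¹ ≤ lambdaMin (gramian N B t₀ T τ x₀ u)}

/-- The radius `ζ(y) = C ‖B‖_∞ e^{Λ₁ (T - t₀)} |y|`. -/
def controlRadius {d k : ℕ} (B : ℝ → Euc d → (Euc k →L[ℝ] Euc d)) (t₀ T Λ₁ C : ℝ)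
    (y : Euc d) : ℝ :=
  C * inputNorm B t₀ T * Real.exp (Λ₁ * (T - t₀)) * ‖y‖

/-- The feasibility ball `ℱ(y) = {u ∈ ℱ(C) : ‖u‖_∞ ≤ ζ(y)}`. -/
def feasibilityBall {d k : ℕ} (N : ℝ → Euc d → Euc d) (B : ℝ → Euc d → (Euc k →L[ℝ] Euc d))
    (t₀ T τ Λ₁ : ℝ) (x₀ : Euc d) (C : ℝ) (y : Euc d) : Set (Control k t₀ T) :=
  {u | u ∈ coercivityClass N B t₀ T τ x₀ C ∧ ‖u‖ ≤ controlRadius B t₀ T Λ₁ C y}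

/-- The zero-control Gramian `W_i(T) = 𝒩_i(0)`. -/
def zeroGramian {d k : ℕ} (N : ℝ → Euc d → Euc d) (B : ℝ → Euc d → (Euc k →L[ℝ] Euc d))
    (t₀ T τ : ℝ) (x₀ : Euc d) : Euc d →L[ℝ] Euc d :=
  gramian N B t₀ T τ x₀ 0

end

/-! Write K_u for `inputKernel` and 𝒩 for `gramian`. A fixed point of `synthesis` has the form u =
K_uᵀ p with p = 𝒩(u)† y, so the search in L^∞ can be replaced by a search for the vector p in ℝᵈ.
For given p, the implicit relation u = K_uᵀ p is solved by feedback: substituting u(t) = K(t,x)ᵀ p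
into the state equation gives an ODE that is Lipschitz in x, and its solution defines a control
U(p), locally Lipschitz in p (`exists_feedback_control`). A fixed point of p ↦ 𝒩(U(p))† y on the
ball |p| ≤ C|y| then yields the fixed point U(p) of `synthesis`. Brouwer's theorem is enough; no
compactness in L^∞ enters.

Invariance rests on one loop of estimates. Since |K_u| ≤ e^{Λ₁(T-t₀)}‖B‖_∞ almost everywhere, any
control K_uᵀ p with |p| ≤ C|y| has norm at most ζ(y). On that norm ball 𝒩 stays within Lζ(y) ≤
θλ/(1+θ) of 𝒩(0), and the smallest eigenvalue is 1-Lipschitz, hence λ_min ≥ λ/(1+θ) = 1/C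
(`inv_le_lambdaMin_gramian`). Thus the norm bound already implies coercivity, and coercivity returns
|𝒩(u)† y| ≤ C|y| (`apply_pinv_of_coercive`). The energy of a fixed point is ⟨𝒩(u)p, p⟩ = ⟨y, p⟩ ≤
C|y|².

Positivity of λ for either reference time comes from the cocycle property of the flow: the two
zero-control Gramians are congruent through an invertible differential
(`lambdaMin_zeroGramian_pos`). The analytic input is Grönwall stability for Carathéodory equations
(`IsSolution.norm_sub_le`), which gives the Lipschitz bounds on the flow, its differential, the
trajectories and U. -/

/-! ### Brouwer's fixed point theorem, by the volume-polynomial proof of the no-retraction theorem.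
-/

section Brouwer

open Metric Polynomial Topology

variable {E : Type*} [NormedAddCommGroup E] [InnerProductSpace ℝ E] [FiniteDimensional ℝ E]

/-- `det (1 + t A)` is a polynomial in `t`, of degree at most the dimension. -/
theorem exists_polynomial_eval_eq_det_id_add_smul (A : E →L[ℝ] E) :
    ∃ p : ℝ[X], p.degree < (Module.finrank ℝ E + 1 : ℕ) ∧
      ∀ t : ℝ, p.eval t = (ContinuousLinearMap.id ℝ E + t • A).det := by
  classical
  let b := Module.finBasis ℝ E
  let M := LinearMap.toMatrix b b (A : E →ₗ[ℝ] E)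
  refine ⟨((X : ℝ[X]) • M.map C + (1 : Matrix _ _ ℝ).map C).det, ?_, fun t => ?_⟩
  · have h := Polynomial.natDegree_det_X_add_C_le M 1
    refine lt_of_le_of_lt Polynomial.degree_le_natDegree ?_
    rw [Fintype.card_fin] at h
    exact_mod_cast Nat.lt_succ_of_le h
  · have h1 : (ContinuousLinearMap.id ℝ E + t • A).det
        = LinearMap.det (LinearMap.id + t • (A : E →ₗ[ℝ] E)) := rfl
    rw [h1, ← LinearMap.det_toMatrix b, map_add, map_smul, LinearMap.toMatrix_id]
    rw [← Polynomial.coe_evalRingHom, RingHom.map_det]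
    congr 1
    ext i j
    simp [M, Matrix.one_apply, add_comm]
    split_ifs <;> simp [mul_comm]

/-- A map which is close to the identity and is the identity on the unit sphere maps the open unit
ball onto itself. -/
theorem image_ball_eq_of_lipschitz_perturbation {g : E → E} {c : ℝ≥0}
    (hc : c < 1) (hg : LipschitzOnWith c g (closedBall 0 1))
    (h0 : ∀ x ∈ sphere (0 : E) 1, g x = 0)
    (hmap : ∀ x ∈ ball (0 : E) 1, x + g x ∈ ball (0 : E) 1) :
    InjOn (fun x => x + g x) (closedBall 0 1) ∧
      (fun x => x + g x) '' ball 0 1 = ball 0 1 := by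
  set F : E → E := fun x => x + g x with hF
  have happ : ApproximatesLinearOn F (ContinuousLinearMap.id ℝ E) (closedBall 0 1) c := by
    rw [ApproximatesLinearOn.approximatesLinearOn_iff_lipschitzOnWith]
    convert hg using 1
    ext x; simp [hF]
  have hinj : InjOn F (closedBall 0 1) := by
    intro x hx y hy hxy
    have h := happ x hx y hy
    rw [hxy, sub_self, zero_sub, norm_neg, ContinuousLinearMap.id_apply] at h
    have : ‖x - y‖ ≤ 0 := by
      have hc' : (c : ℝ) < 1 := hc
      nlinarith [norm_nonneg (x - y)]
    exact sub_eq_zero.1 (norm_le_zero_iff.1 this)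
  refine ⟨hinj, ?_⟩
  have hopen : IsOpen (F '' ball 0 1) := by
    -- The identity inverts itself with norm 1, so the open-image criterion reduces to `c < 1`.
    let R : (ContinuousLinearMap.id ℝ E).NonlinearRightInverse :=
      { toFun := fun x => x, nnnorm := 1, bound' := by simp, right_inv' := by simp }
    exact (happ.mono_set ball_subset_closedBall).open_image R isOpen_ball
      (Or.inr (by simpa [R] using hc))
  have hsub : F '' ball 0 1 ⊆ ball 0 1 := by
    rintro _ ⟨x, hx, rfl⟩; exact hmap x hx
  have hcont : ContinuousOn F (closedBall 0 1) := continuousOn_id.add hg.continuousOn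
  have hclosed : IsClosed (F '' closedBall 0 1) :=
    ((isCompact_closedBall 0 1).image_of_continuousOn hcont).isClosed
  -- Sphere points are fixed, so they never land in the open ball. The image of the open ball is
  -- therefore both open and relatively closed in the ball, and connectedness makes it everything.
  have hinter : F '' closedBall 0 1 ∩ ball 0 1 ⊆ F '' ball 0 1 := by
    rintro _ ⟨⟨x, hx, rfl⟩, hb⟩
    rcases (mem_closedBall_zero_iff.1 hx).lt_or_eq with h | h
    · exact ⟨x, mem_ball_zero_iff.2 h, rfl⟩
    · have hs : F x = x := by simp [hF, h0 x (mem_sphere_zero_iff_norm.2 h)]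
      rw [hs, mem_ball_zero_iff] at hb
      exact absurd h hb.ne
  refine hsub.antisymm ?_
  have hpre : IsPreconnected (ball (0 : E) 1) := (convex_ball 0 1).isPreconnected
  by_contra hcon
  obtain ⟨z, hz, hz'⟩ := not_subset.1 hcon
  obtain ⟨w, hw, hw1, hw2⟩ := hpre _ _ hopen hclosed.isOpen_compl
    (fun x hx => by
      by_cases h : x ∈ F '' closedBall 0 1
      · exact Or.inl (hinter ⟨h, hx⟩)
      · exact Or.inr h)
    ⟨F 0, hmap 0 (by simp), ⟨0, by simp, rfl⟩⟩
    ⟨z, hz, fun h => hz' (hinter ⟨h, hz⟩)⟩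
  exact hw2 (image_mono ball_subset_closedBall hw1)

/-- There is no `C¹` retraction of the closed unit ball onto the unit sphere. -/
theorem not_exists_contDiffOn_retraction {U : Set E} (hU : IsOpen U) (hBU : closedBall 0 1 ⊆ U)
    {r : E → E} (hr : ContDiffOn ℝ 1 r U) (hrs : ∀ x ∈ closedBall (0 : E) 1, ‖r x‖ = 1)
    (hid : ∀ x ∈ sphere (0 : E) 1, r x = x) : False := by
  let _ : MeasurableSpace E := borel E
  have _ : BorelSpace E := ⟨rfl⟩
  set B : Set E := ball 0 1 with hB
  have hBU' : B ⊆ U := ball_subset_closedBall.trans hBU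
  set A : E → E →L[ℝ] E := fun x => fderiv ℝ r x - ContinuousLinearMap.id ℝ E with hA
  have hAcont : ContinuousOn A (closedBall 0 1) :=
    ((hr.continuousOn_fderiv_of_isOpen hU le_rfl).mono hBU).sub continuousOn_const
  have hrd : ∀ x ∈ U, HasFDerivAt r (fderiv ℝ r x) x := fun x hx =>
    ((hr.differentiableOn one_ne_zero).differentiableAt (hU.mem_nhds hx)).hasFDerivAt
  have hgd : ∀ x ∈ U, HasFDerivAt (fun x => r x - x) (A x) x := fun x hx =>
    (hrd x hx).sub (hasFDerivAt_id x)
  obtain ⟨c, hc0, hc⟩ : ∃ c : ℝ, 0 < c ∧ ∀ x ∈ closedBall (0 : E) 1, ‖A x‖ ≤ c := by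
    obtain ⟨c, hc⟩ := (isCompact_closedBall (0 : E) 1).exists_bound_of_continuousOn hAcont
    exact ⟨max c 1, by positivity, fun x hx => (hc x hx).trans (le_max_left _ _)⟩
  have hlip : ∀ x ∈ closedBall (0 : E) 1, ∀ y ∈ closedBall (0 : E) 1,
      ‖(r x - x) - (r y - y)‖ ≤ c * ‖x - y‖ := fun x hx y hy =>
    (convex_closedBall (0 : E) 1).norm_image_sub_le_of_norm_hasFDerivWithin_le
      (fun z hz => (hgd z (hBU hz)).hasFDerivWithinAt) hc hy hx
  obtain ⟨δ, hδ, hdet⟩ : ∃ δ > 0, ∀ L : E →L[ℝ] E, ‖L‖ < δ →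
      0 < (ContinuousLinearMap.id ℝ E + L).det := by
    have h1 : ContinuousAt (fun L : E →L[ℝ] E => (ContinuousLinearMap.id ℝ E + L).det) 0 :=
      (ContinuousLinearMap.continuous_det.comp (continuous_const.add continuous_id)).continuousAt
    have h2 : (0 : ℝ) < (ContinuousLinearMap.id ℝ E + (0 : E →L[ℝ] E)).det := by
      rw [add_zero]; simp [ContinuousLinearMap.det]
    obtain ⟨δ, hδ, h⟩ := Metric.eventually_nhds_iff.1 (h1.eventually_const_lt h2)
    exact ⟨δ, hδ, fun L hL => h (by simpa using hL)⟩
  have hintegrable : ∀ t : ℝ,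
      IntegrableOn (fun x => (ContinuousLinearMap.id ℝ E + t • A x).det) B volume := fun t => by
    refine IntegrableOn.mono_set ?_ ball_subset_closedBall
    refine ContinuousOn.integrableOn_compact (isCompact_closedBall 0 1) ?_
    exact ContinuousLinearMap.continuous_det.comp_continuousOn
      (continuousOn_const.add (hAcont.const_smul t))
  -- For small t the map x + t(r x - x) is a bijection of the ball with positive Jacobian, so the
  -- integral of the Jacobian is the volume of the ball.
  have hsmall : ∀ t : ℝ, 0 < t → t < 1 → t * c < 1 → t * c < δ →
      ∫ x in B, (ContinuousLinearMap.id ℝ E + t • A x).det = volume.real B := by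
    intro t ht ht1 htc htδ
    have hLip : LipschitzOnWith (Real.toNNReal (t * c)) (fun x => t • (r x - x))
        (closedBall 0 1) := by
      refine LipschitzOnWith.of_dist_le_mul fun x hx y hy => ?_
      rw [dist_eq_norm, dist_eq_norm, ← smul_sub, norm_smul, Real.norm_of_nonneg ht.le,
        Real.coe_toNNReal _ (by positivity), mul_assoc]
      exact mul_le_mul_of_nonneg_left (hlip x hx y hy) ht.le
    obtain ⟨hinj, himg⟩ := image_ball_eq_of_lipschitz_perturbation (g := fun x => t • (r x - x))
      (c := Real.toNNReal (t * c)) (by simpa using htc) hLip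
      (fun x hx => by simp [hid x hx]) (fun x hx => by
        have h1 : ‖r x‖ = 1 := hrs x (ball_subset_closedBall hx)
        rw [mem_ball_zero_iff] at hx ⊢
        have h2 : x + t • (r x - x) = (1 - t) • x + t • r x := by module
        rw [h2]
        calc ‖(1 - t) • x + t • r x‖ ≤ ‖(1 - t) • x‖ + ‖t • r x‖ := norm_add_le _ _
          _ = (1 - t) * ‖x‖ + t := by
            rw [norm_smul, norm_smul, Real.norm_of_nonneg ht.le,
              Real.norm_of_nonneg (by linarith), h1, mul_one]
          _ < 1 := by nlinarith)
    have hcv := integral_image_eq_integral_abs_det_fderiv_smul volume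
      (measurableSet_ball (x := (0 : E)) (ε := 1)) (f := fun x => x + t • (r x - x))
      (f' := fun x => ContinuousLinearMap.id ℝ E + t • A x)
      (fun x hx => ((hasFDerivAt_id x).add ((hgd x (hBU' hx)).const_smul t)).hasFDerivWithinAt)
      (hinj.mono ball_subset_closedBall) (fun _ => (1 : ℝ))
    rw [himg] at hcv
    rw [setIntegral_const] at hcv
    simp only [smul_eq_mul, mul_one] at hcv
    rw [hB, hcv]
    refine setIntegral_congr_fun measurableSet_ball fun x hx => (abs_of_pos (hdet _ ?_)).symm
    rw [norm_smul, Real.norm_of_nonneg ht.le]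
    exact lt_of_le_of_lt
      (mul_le_mul_of_nonneg_left (hc x (ball_subset_closedBall hx)) ht.le) htδ
  choose p hpdeg hpeval using fun x => exists_polynomial_eval_eq_det_id_add_smul (A x)
  set n := Module.finrank ℝ E + 1 with hn
  obtain ⟨ε, hε0, hε1, hεc, hεδ⟩ : ∃ ε : ℝ, 0 < ε ∧ ε < 1 ∧ ε * c < 1 ∧ ε * c < δ := by
    refine ⟨min (1 / 2) (min (1 / 2 / c) (δ / 2 / c)), by positivity, ?_, ?_, ?_⟩
    · exact lt_of_le_of_lt (min_le_left _ _) (by norm_num)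
    · calc _ ≤ (1 / 2 / c) * c := by gcongr; exact (min_le_right _ _).trans (min_le_left _ _)
        _ < 1 := by field_simp; norm_num
    · calc _ ≤ (δ / 2 / c) * c := by gcongr; exact (min_le_right _ _).trans (min_le_right _ _)
        _ < δ := by field_simp; linarith
  -- The Jacobian is a polynomial in t of degree less than n, so n distinct small nodes determine
  -- its value at t = 1. Interpolating pointwise in x carries the volume identity from the nodes to
  -- t = 1 with weights that do not depend on x.
  let v : Fin n → ℝ := fun i => ε / (i + 1 : ℝ)
  have hv : Function.Injective v := by
    intro i j hij
    have h1 : (0 : ℝ) < i + 1 := by positivity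
    have h2 : (0 : ℝ) < j + 1 := by positivity
    have : ε / (i + 1 : ℝ) = ε / (j + 1 : ℝ) := hij
    rw [div_eq_div_iff h1.ne' h2.ne'] at this
    have := mul_left_cancel₀ hε0.ne' this
    exact Fin.ext (by exact_mod_cast (add_right_cancel this).symm)
  have hv0 : ∀ i, 0 < v i := fun i => by positivity
  have hvle : ∀ i, v i ≤ ε := fun i => by
    have : (0 : ℝ) ≤ (i : ℝ) := by positivity
    exact div_le_self hε0.le (by linarith)
  have hvsmall : ∀ i, ∫ x in B, (ContinuousLinearMap.id ℝ E + v i • A x).det = volume.real B :=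
    fun i => hsmall _ (hv0 i) ((hvle i).trans_lt hε1)
      ((mul_le_mul_of_nonneg_right (hvle i) hc0.le).trans_lt hεc)
      ((mul_le_mul_of_nonneg_right (hvle i) hc0.le).trans_lt hεδ)
  have hinterp : ∀ x, (p x).eval 1 = ∑ i : Fin n,
      (ContinuousLinearMap.id ℝ E + v i • A x).det * (Lagrange.basis Finset.univ v i).eval 1 := by
    intro x
    have h := Lagrange.eq_interpolate (s := Finset.univ) (v := v) (f := p x) hv.injOn
      (by simpa using hpdeg x)
    conv_lhs => rw [h]
    simp [Lagrange.interpolate_apply, eval_finsetSum, hpeval]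
  have hone : ∑ i : Fin n, (Lagrange.basis Finset.univ v i).eval (1 : ℝ) = 1 := by
    have h := Lagrange.sum_basis (s := Finset.univ) (v := v) hv.injOn ⟨0, Finset.mem_univ _⟩
    rw [← eval_finsetSum, h, eval_one]
  have hvol : ∫ x in B, (p x).eval 1 = volume.real B := by
    simp_rw [hinterp]
    rw [integral_finsetSum]
    · simp_rw [integral_mul_const, hvsmall]
      rw [← Finset.mul_sum, hone, mul_one]
    · exact fun i _ => (hintegrable (v i)).mul_const _
  -- At t = 1 the Jacobian is det Dr. As |r| = 1, the range of Dr(x) is orthogonal to r(x) ≠ 0, so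
  -- Dr(x) is singular.
  have hzero : ∀ x ∈ B, (p x).eval 1 = 0 := by
    intro x hx
    rw [hpeval, one_smul]
    have hAx : ContinuousLinearMap.id ℝ E + A x = fderiv ℝ r x := by simp [hA]
    rw [hAx]
    by_contra hne
    have hx1 : ‖r x‖ = 1 := hrs x (ball_subset_closedBall hx)
    have hsurj : Function.Surjective (fderiv ℝ r x) :=
      (LinearMap.equivOfDetNeZero (fderiv ℝ r x : E →ₗ[ℝ] E) hne).surjective
    obtain ⟨w, hw⟩ := hsurj (r x)
    have h1 : HasFDerivAt (fun y => ‖r y‖ ^ 2) (2 • (innerSL ℝ (r x)).comp (fderiv ℝ r x)) x :=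
      (hrd x (hBU' hx)).norm_sq
    have h2 : HasFDerivAt (fun y => ‖r y‖ ^ 2) (0 : E →L[ℝ] ℝ) x := by
      refine (hasFDerivAt_const (1 : ℝ) x).congr_of_eventuallyEq ?_
      filter_upwards [isOpen_ball.mem_nhds hx] with y hy
      rw [hrs y (ball_subset_closedBall hy), one_pow]
    have h3 := congrArg (fun L : E →L[ℝ] ℝ => L w) (h1.unique h2)
    simp [hw, hx1] at h3
  rw [setIntegral_congr_fun measurableSet_ball hzero] at hvol
  simp only [integral_zero] at hvol
  have hpos : 0 < volume.real B :=
    ENNReal.toReal_pos (measure_ball_pos volume _ one_pos).ne' measure_ball_lt_top.ne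
  exact hpos.ne hvol

/-- Brouwer's theorem for smooth self-maps of the unit ball. -/
theorem exists_fixedPoint_of_contDiff {P : E → E} (hP : ContDiff ℝ 1 P)
    (hmap : MapsTo P (closedBall 0 1) (closedBall 0 1)) :
    ∃ x ∈ closedBall (0 : E) 1, P x = x := by
  by_contra! hne
  set v : E → E := fun x => x - P x with hv
  set a : E → ℝ := fun x => inner ℝ (v x) (v x) with ha
  set b : E → ℝ := fun x => inner ℝ x (v x) with hb
  -- A quarter of the discriminant of |x + λ v(x)|² = 1 as a quadratic in λ. The larger root pushes
  -- x along the ray from P x through x to the sphere.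
  set D : E → ℝ := fun x => b x ^ 2 - a x * (‖x‖ ^ 2 - 1) with hD
  have hvs : ContDiff ℝ 1 v := contDiff_id.sub hP
  have has : ContDiff ℝ 1 a := hvs.inner ℝ hvs
  have hbs : ContDiff ℝ 1 b := contDiff_id.inner ℝ hvs
  have hDs : ContDiff ℝ 1 D :=
    (hbs.pow 2).sub (has.mul ((contDiff_norm_sq ℝ).sub contDiff_const))
  have hapos : ∀ x ∈ closedBall (0 : E) 1, 0 < a x := fun x hx => by
    have : v x ≠ 0 := fun h => hne x hx (sub_eq_zero.1 h).symm
    exact real_inner_self_pos.2 this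
  -- On the sphere 2b = a + 1 - |P x|² ≥ a > 0. Hence the larger root is 0 there, and the retraction
  -- fixes the sphere.
  have hbpos : ∀ x ∈ sphere (0 : E) 1, 0 < b x := fun x hx => by
    have hx1 : ‖x‖ = 1 := mem_sphere_zero_iff_norm.1 hx
    have hx' : x ∈ closedBall (0 : E) 1 := sphere_subset_closedBall hx
    have hP1 : ‖P x‖ ≤ 1 := mem_closedBall_zero_iff.1 (hmap hx')
    have h1 : a x = ‖x‖ ^ 2 - 2 * inner ℝ x (P x) + ‖P x‖ ^ 2 := by
      rw [ha]; simp only [hv]; rw [real_inner_self_eq_norm_sq, norm_sub_sq_real]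
    have h2 : b x = ‖x‖ ^ 2 - inner ℝ x (P x) := by
      simp only [hb, hv]; rw [inner_sub_right, real_inner_self_eq_norm_sq]
    have h3 := hapos x hx'
    rw [hx1] at h1 h2
    nlinarith [norm_nonneg (P x)]
  have hDpos : ∀ x ∈ closedBall (0 : E) 1, 0 < D x := fun x hx => by
    rcases (mem_closedBall_zero_iff.1 hx).lt_or_eq with h | h
    · have h1 := hapos x hx
      have h2 : ‖x‖ ^ 2 - 1 < 0 := by nlinarith [norm_nonneg x]
      simp only [hD]; nlinarith [sq_nonneg (b x), mul_neg_of_pos_of_neg h1 h2]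
    · have h1 := hbpos x (mem_sphere_zero_iff_norm.2 h)
      simp only [hD, h]; nlinarith
  set U : Set E := {x | 0 < a x} ∩ {x | 0 < D x} with hU
  have hUo : IsOpen U := (isOpen_lt continuous_const has.continuous).inter
    (isOpen_lt continuous_const hDs.continuous)
  refine not_exists_contDiffOn_retraction hUo (fun x hx => ⟨hapos x hx, hDpos x hx⟩)
    (r := fun x => x + ((-b x + √(D x)) / a x) • v x) ?_ ?_ ?_
  · refine contDiff_id.contDiffOn.add (ContDiffOn.smul ?_ hvs.contDiffOn)
    refine ContDiffOn.div (hbs.neg.contDiffOn.add ?_) has.contDiffOn fun x hx => hx.1.ne'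
    exact hDs.contDiffOn.sqrt fun x hx => hx.2.ne'
  · intro x hx
    have h1 : ‖x + ((-b x + √(D x)) / a x) • v x‖ ^ 2 = 1 := by
      rw [norm_add_sq_real, inner_smul_right, norm_smul, mul_pow, Real.norm_eq_abs, sq_abs,
        ← real_inner_self_eq_norm_sq (v x)]
      change ‖x‖ ^ 2 + 2 * ((-b x + √(D x)) / a x * b x) + ((-b x + √(D x)) / a x) ^ 2 * a x = 1
      have hs := Real.sq_sqrt (hDpos x hx).le
      have h0 := (hapos x hx).ne'
      field_simp
      have hDx : D x = b x ^ 2 - a x * (‖x‖ ^ 2 - 1) := rfl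
      nlinarith
    exact (pow_eq_one_iff_of_nonneg (norm_nonneg _) two_ne_zero).1 h1
  · intro x hx
    have h1 : D x = b x ^ 2 := by simp [hD, mem_sphere_zero_iff_norm.1 hx]
    simp [h1, Real.sqrt_sq (hbpos x hx).le]

/-- **Brouwer's fixed point theorem** for a closed ball of a finite-dimensional inner product
space. -/
theorem exists_fixedPoint_of_continuousOn_closedBall {f : E → E} {R : ℝ} (hR : 0 ≤ R)
    (hf : ContinuousOn f (closedBall 0 R)) (hmap : MapsTo f (closedBall 0 R) (closedBall 0 R)) :
    ∃ x ∈ closedBall (0 : E) R, f x = x := by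
  rcases hR.eq_or_lt with rfl | hR
  · have h0 : (0 : E) ∈ closedBall (0 : E) 0 := by simp
    have := hmap h0
    exact ⟨0, h0, by simpa using this⟩
  suffices H : ∀ h : E → E, ContinuousOn h (closedBall 0 1) →
      MapsTo h (closedBall 0 1) (closedBall 0 1) → ∃ x ∈ closedBall (0 : E) 1, h x = x by
    have hsc : MapsTo (fun x : E => R • x) (closedBall 0 1) (closedBall 0 R) := fun x hx => by
      rw [mem_closedBall_zero_iff] at hx ⊢
      rw [norm_smul, Real.norm_of_nonneg hR.le]
      nlinarith
    obtain ⟨x, hx, hfx⟩ := H (fun x => R⁻¹ • f (R • x))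
      (continuousOn_const.smul (hf.comp (continuous_const_smul R).continuousOn hsc))
      (fun x hx => by
        have := mem_closedBall_zero_iff.1 (hmap (hsc hx))
        rw [mem_closedBall_zero_iff, norm_smul, norm_inv, Real.norm_of_nonneg hR.le]
        rw [inv_mul_le_iff₀ hR]; simpa using this)
    refine ⟨R • x, hsc hx, ?_⟩
    have h2 : R • (R⁻¹ • f (R • x)) = R • x := congrArg (R • ·) hfx
    rwa [smul_smul, mul_inv_cancel₀ hR.ne', one_smul] at h2
  intro h hcont hmaps
  by_contra! hne
  -- Tietze extension to the whole space makes smooth approximation available.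
  obtain ⟨h', hh'⟩ : ∃ h' : C(E, E), (h'.restrict (closedBall 0 1)) =
      ⟨_, hcont.domRestrict⟩ := ContinuousMap.exists_restrict_eq isClosed_closedBall _
  have heq : ∀ x ∈ closedBall (0 : E) 1, h' x = h x := fun x hx =>
    congrArg (fun q : C(closedBall (0 : E) 1, E) => q ⟨x, hx⟩) hh'
  obtain ⟨x₀, hx₀, hmin⟩ := (isCompact_closedBall (0 : E) 1).exists_isMinOn
    ⟨0, by simp⟩ (continuousOn_id.sub hcont).norm
  have hδ : 0 < ‖x₀ - h x₀‖ := norm_pos_iff.2 fun h0 => hne x₀ hx₀ (sub_eq_zero.1 h0).symm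
  set δ := ‖x₀ - h x₀‖ with hδdef
  have hδle : ∀ x ∈ closedBall (0 : E) 1, δ ≤ ‖x - h x‖ := fun x hx => hmin hx
  obtain ⟨g, hg, hgd, -⟩ := h'.continuous.exists_contDiff_approx 1 (ε := fun _ => δ / 3)
    continuous_const (fun _ => by positivity)
  have hgn : ∀ x ∈ closedBall (0 : E) 1, ‖g x - h x‖ < δ / 3 := fun x hx => by
    rw [← heq x hx, ← dist_eq_norm]; exact hgd x
  have hgn1 : ∀ x ∈ closedBall (0 : E) 1, ‖g x‖ ≤ 1 + δ / 3 := fun x hx => by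
    have h1 := mem_closedBall_zero_iff.1 (hmaps hx)
    have h2 := norm_sub_norm_le (g x) (h x)
    linarith [hgn x hx]
  have hpos : 0 < 1 + δ / 3 := by positivity
  -- The rescaling brings the approximation back into the ball. Approximating and rescaling cost δ/3
  -- each, which is still below the minimal displacement δ.
  obtain ⟨x, hx, hfix⟩ := exists_fixedPoint_of_contDiff (P := fun x => (1 + δ / 3)⁻¹ • g x)
    (contDiff_const.smul hg) (fun x hx => by
      rw [mem_closedBall_zero_iff, norm_smul, norm_inv, Real.norm_of_nonneg hpos.le,
        inv_mul_le_iff₀ hpos, mul_one]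
      exact hgn1 x hx)
  have h1 : g x = (1 + δ / 3) • x := by
    rw [← hfix, smul_smul, mul_inv_cancel₀ hpos.ne', one_smul]
    simp only [hfix]
  have h2 : x - h x = (g x - h x) - (δ / 3) • x := by rw [h1]; module
  have h3 : ‖x - h x‖ ≤ ‖g x - h x‖ + δ / 3 * ‖x‖ := by
    rw [h2]
    refine (norm_sub_le _ _).trans ?_
    rw [norm_smul, Real.norm_of_nonneg (by positivity)]
  have h4 := hδle x hx
  have h5 := hgn x hx
  have h6 := mem_closedBall_zero_iff.1 hx
  nlinarith

end Brouwer

/-! ### Carathéodory equations: measurability, Grönwall, stability, existence and uniqueness. -/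

section Caratheodory

open Filter Topology

/-- Composition of a Carathéodory function (measurable in `t`, continuous in `x`) with a measurable
curve is measurable. -/
theorem aestronglyMeasurable_comp_of_caratheodory {α X F : Type*} [MeasurableSpace α]
    [PseudoMetricSpace X] [NormedAddCommGroup F] {μ : Measure α} {f : α → X → F}
    (hc : ∀ᵐ t ∂μ, Continuous (f t)) (hm : ∀ x, AEStronglyMeasurable (fun t => f t x) μ)
    {γ : α → X} (hγ : AEStronglyMeasurable γ μ) :
    AEStronglyMeasurable (fun t => f t (γ t)) μ := by
  classical
  have hS := hγ.stronglyMeasurable_mk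
  set S := hγ.mk γ with hSdef
  have h1 : AEStronglyMeasurable (fun t => f t (S t)) μ := by
    refine aestronglyMeasurable_of_tendsto_ae atTop (f := fun n t => f t (hS.approx n t))
      (fun n => ?_) ?_
    -- Along a simple curve only finitely many slices f(·, x) occur, so their exceptional null sets
    -- can be united; continuity in x then handles the limit of simple curves.
    · have key : ∀ σ : SimpleFunc α X, AEStronglyMeasurable (fun t => f t (σ t)) μ := by
        intro σ
        choose g hg hgf using fun x => hm x
        refine ⟨fun t => g (σ t) t, ?_, ?_⟩
        · have h2 : (fun t => g (σ t) t) =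
              fun t => ∑ x ∈ σ.range, (σ ⁻¹' {x}).indicator (g x) t := by
            funext t
            rw [Finset.sum_eq_single (σ t)]
            · simp
            · intro x _ hx
              exact indicator_of_notMem (fun h => hx h.symm) _
            · exact fun h => (h (SimpleFunc.mem_range_self σ t)).elim
          rw [h2]
          exact Finset.stronglyMeasurable_fun_sum _ fun x _ =>
            (hg x).indicator (σ.measurableSet_fiber x)
        · have : ∀ᵐ t ∂μ, ∀ x ∈ σ.range, f t x = g x t := by
            rw [Filter.eventually_all_finset]
            exact fun x _ => hgf x
          filter_upwards [this] with t ht using ht _ (SimpleFunc.mem_range_self σ t)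
      exact key _
    · filter_upwards [hc] with t ht
      exact (ht.tendsto (S t)).comp (hS.tendsto_approx t)
  refine h1.congr ?_
  filter_upwards [hγ.ae_eq_mk] with t ht
  rw [← hSdef] at ht
  rw [ht]

/-- Grönwall's inequality in integral form. -/
theorem le_mul_exp_of_le_add_mul_integral {g : ℝ → ℝ} {a K R : ℝ} (hK : 0 ≤ K)
    (hg : ContinuousOn g (Icc 0 R)) (h : ∀ t ∈ Icc 0 R, g t ≤ a + K * ∫ r in (0)..t, g r) :
    ∀ t ∈ Icc 0 R, g t ≤ a * Real.exp (K * t) := by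
  intro t ht
  have hR : (0 : ℝ) ≤ R := ht.1.trans ht.2
  -- A continuous extension to the whole line makes the primitive differentiable at the endpoints
  -- too.
  set G : ℝ → ℝ := IccExtend hR ((Icc 0 R).domRestrict g) with hG
  have hGc : Continuous G := hg.domRestrict.Icc_extend'
  have hGg : ∀ r ∈ Icc 0 R, G r = g r := fun r hr => by
    rw [hG, IccExtend_of_mem hR _ hr]; rfl
  have hint : ∀ r ∈ Icc 0 R, ∫ ρ in (0)..r, G ρ = ∫ ρ in (0)..r, g ρ := fun r hr => by
    refine intervalIntegral.integral_congr fun ρ hρ => hGg ρ ?_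
    rw [uIcc_of_le hr.1] at hρ
    exact ⟨hρ.1, hρ.2.trans hr.2⟩
  set H : ℝ → ℝ := fun r => a + K * ∫ ρ in (0)..r, G ρ with hH
  have hHd : ∀ r, HasDerivAt H (K * G r) r := fun r =>
    ((intervalIntegral.integral_hasDerivAt_right (hGc.intervalIntegrable _ _)
      (hGc.stronglyMeasurableAtFilter _ _) hGc.continuousAt).const_mul K).const_add a
  have hqd : ∀ r, HasDerivAt (fun r => Real.exp (-(K * r)) * H r)
      (Real.exp (-(K * r)) * (-(K * 1)) * H r + Real.exp (-(K * r)) * (K * G r)) r := fun r =>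
    (((hasDerivAt_id r).const_mul K).neg.exp).mul (hHd r)
  have hanti : AntitoneOn (fun r => Real.exp (-(K * r)) * H r) (Icc 0 R) := by
    refine antitoneOn_of_deriv_nonpos (convex_Icc 0 R)
      (fun r _ => (hqd r).continuousAt.continuousWithinAt)
      (fun r _ => (hqd r).differentiableAt.differentiableWithinAt) fun r hr => ?_
    rw [(hqd r).deriv]
    rw [interior_Icc] at hr
    have hr' := Ioo_subset_Icc_self hr
    have h1 : G r ≤ H r := by
      rw [hGg r hr']; simp only [hH]; rw [hint r hr']; exact h r hr'
    have h2 : K * G r ≤ K * H r := mul_le_mul_of_nonneg_left h1 hK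
    have h3 := Real.exp_pos (-(K * r))
    nlinarith
  have h1 := hanti ⟨le_rfl, hR⟩ ht ht.1
  simp only [hH, intervalIntegral.integral_same, mul_zero, neg_zero, Real.exp_zero, one_mul,
    add_zero] at h1
  have h2 : g t ≤ H t := by simp only [hH]; rw [hint t ht]; exact h t ht
  refine h2.trans ?_
  rw [Real.exp_neg, inv_mul_le_iff₀ (Real.exp_pos _)] at h1
  linarith

/-- Two-sided Grönwall inequality in integral form. -/
theorem le_mul_exp_abs_of_le_add_mul_abs_integral {g : ℝ → ℝ} {a K t₀ T s : ℝ} (hK : 0 ≤ K)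
    (hg : ContinuousOn g (Icc t₀ T)) (h0 : ∀ t, 0 ≤ g t) (hs : s ∈ Icc t₀ T)
    (h : ∀ t ∈ Icc t₀ T, g t ≤ a + K * |∫ r in s..t, g r|) :
    ∀ t ∈ Icc t₀ T, g t ≤ a * Real.exp (K * |t - s|) := by
  intro t ht
  rcases le_total s t with hst | hst
  · have h1 := le_mul_exp_of_le_add_mul_integral (g := fun r => g (s + r)) (a := a) (R := T - s) hK
      (hg.comp (by fun_prop) fun r hr => ⟨by linarith [hr.1, hs.1], by linarith [hr.2]⟩)
      (fun r hr => by
        have h2 := h (s + r) ⟨by linarith [hr.1, hs.1], by linarith [hr.2]⟩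
        rw [intervalIntegral.integral_comp_add_left (fun r => g r), add_zero]
        rwa [abs_of_nonneg] at h2
        exact intervalIntegral.integral_nonneg (by linarith [hr.1]) fun _ _ => h0 _)
      (t - s) ⟨by linarith, by linarith [ht.2]⟩
    rw [abs_of_nonneg (by linarith)]
    simpa using h1
  · have h1 := le_mul_exp_of_le_add_mul_integral (g := fun r => g (s - r)) (a := a) (R := s - t₀) hK
      (hg.comp (by fun_prop) fun r hr => ⟨by linarith [hr.2], by linarith [hr.1, hs.2]⟩)
      (fun r hr => by
        have h2 := h (s - r) ⟨by linarith [hr.2], by linarith [hr.1, hs.2]⟩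
        rw [intervalIntegral.integral_comp_sub_left (fun r => g r), sub_zero]
        rwa [intervalIntegral.integral_symm, abs_neg, abs_of_nonneg] at h2
        exact intervalIntegral.integral_nonneg (by linarith [hr.1]) fun _ _ => h0 _)
      (s - t) ⟨by linarith, by linarith [ht.1]⟩
    rw [abs_of_nonpos (by linarith)]
    simpa using h1

/-- Integrating the exponential weight gains a factor 1/l. This makes the Picard map a contraction
on the whole interval at once. -/
theorem abs_integral_exp_mul_abs_le {l : ℝ} (hl : 0 < l) (s t : ℝ) :
    |∫ r in s..t, Real.exp (l * |r - s|)| ≤ Real.exp (l * |t - s|) / l := by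
  rcases le_total s t with hst | hst
  · have h1 : ∫ r in s..t, Real.exp (l * |r - s|) = ∫ r in s..t, Real.exp (l * (r - s)) := by
      refine intervalIntegral.integral_congr fun r hr => ?_
      rw [uIcc_of_le hst] at hr
      simp only [abs_of_nonneg (sub_nonneg.2 hr.1)]
    have hd : ∀ r ∈ uIcc s t, HasDerivAt (fun r => Real.exp (l * (r - s)) / l)
        (Real.exp (l * (r - s))) r := fun r _ => by
      have := (((hasDerivAt_id r).sub_const s).const_mul l).exp.div_const l
      simpa [hl.ne'] using this
    rw [h1, intervalIntegral.integral_eq_sub_of_hasDerivAt hd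
      (Continuous.intervalIntegrable (by fun_prop) _ _), abs_of_nonneg (sub_nonneg.2 hst), sub_self,
      mul_zero, Real.exp_zero, abs_of_nonneg]
    · have : (0 : ℝ) ≤ 1 / l := by positivity
      linarith
    · rw [← sub_div]
      have : 1 ≤ Real.exp (l * (t - s)) := Real.one_le_exp (by nlinarith)
      exact div_nonneg (by linarith) hl.le
  · have h1 : ∫ r in s..t, Real.exp (l * |r - s|) = ∫ r in s..t, Real.exp (l * (s - r)) := by
      refine intervalIntegral.integral_congr fun r hr => ?_
      rw [uIcc_of_ge hst] at hr
      simp only [abs_of_nonpos (sub_nonpos.2 hr.2), neg_sub]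
    have hd : ∀ r ∈ uIcc s t, HasDerivAt (fun r => -(Real.exp (l * (s - r)) / l))
        (Real.exp (l * (s - r))) r := fun r _ => by
      have := ((((hasDerivAt_id r).const_sub s).const_mul l).exp.div_const l).neg
      exact this.congr_deriv (by simp; field_simp)
    rw [h1, intervalIntegral.integral_eq_sub_of_hasDerivAt hd
      (Continuous.intervalIntegrable (by fun_prop) _ _), abs_of_nonpos (sub_nonpos.2 hst), sub_self,
      mul_zero, Real.exp_zero, abs_of_nonpos]
    · have : (0 : ℝ) ≤ 1 / l := by positivity
      simp only [neg_sub]; linarith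
    · have : 1 ≤ Real.exp (l * (s - t)) := Real.one_le_exp (by nlinarith)
      have := div_le_div_of_nonneg_right this hl.le
      linarith

variable {d : ℕ}

/-- `f` is measurable and integrable in time and Lipschitz in space. -/
structure IsCaratheodory (f : ℝ → Euc d → Euc d) (t₀ T K : ℝ) : Prop where
  nonneg : 0 ≤ K
  lipschitz : ∀ᵐ t ∂timeMeasure t₀ T, ∀ x y, ‖f t x - f t y‖ ≤ K * ‖x - y‖
  integrable : ∀ x, Integrable (fun t => f t x) (timeMeasure t₀ T)

theorem continuous_of_norm_sub_le {X Y : Type*} [SeminormedAddCommGroup X]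
    [SeminormedAddCommGroup Y] {g : X → Y} {K : ℝ} (h : ∀ x y, ‖g x - g y‖ ≤ K * ‖x - y‖) :
    Continuous g :=
  (LipschitzWith.of_dist_le' (K := K) fun x y => by
    simpa only [dist_eq_norm] using h x y).continuous

theorem ContinuousOn.aestronglyMeasurable_timeMeasure {F : Type*} [TopologicalSpace F]
    [TopologicalSpace.PseudoMetrizableSpace F] {γ : ℝ → F} {t₀ T : ℝ}
    (hγ : ContinuousOn γ (Icc t₀ T)) : AEStronglyMeasurable γ (timeMeasure t₀ T) :=
  (hγ.aestronglyMeasurable_of_isCompact isCompact_Icc measurableSet_Icc).mono_measure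
    (Measure.restrict_mono Ioc_subset_Icc_self le_rfl)

namespace IsCaratheodory

variable {f : ℝ → Euc d → Euc d} {t₀ T K : ℝ}

theorem integrable_comp (hf : IsCaratheodory f t₀ T K) {γ : ℝ → Euc d}
    (hγ : ContinuousOn γ (Icc t₀ T)) : Integrable (fun t => f t (γ t)) (timeMeasure t₀ T) := by
  obtain ⟨c, hc⟩ := isCompact_Icc.exists_bound_of_continuousOn hγ
  refine Integrable.mono' (g := fun t => ‖f t 0‖ + K * c)
    ((hf.integrable 0).norm.add (integrable_const _)) ?_ ?_
  · exact aestronglyMeasurable_comp_of_caratheodory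
      (hf.lipschitz.mono fun t ht => continuous_of_norm_sub_le ht)
      (fun x => (hf.integrable x).aestronglyMeasurable) hγ.aestronglyMeasurable_timeMeasure
  · filter_upwards [hf.lipschitz, ae_restrict_mem measurableSet_Ioc] with t ht htI
    have h1 := ht (γ t) 0
    rw [sub_zero] at h1
    have h2 := hc t (Ioc_subset_Icc_self htI)
    have h3 := norm_le_norm_add_norm_sub' (f t (γ t)) (f t 0)
    have h4 := mul_le_mul_of_nonneg_left h2 hf.nonneg
    linarith

theorem intervalIntegrable_comp (hf : IsCaratheodory f t₀ T K) {γ : ℝ → Euc d}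
    (hγ : ContinuousOn γ (Icc t₀ T)) {s t : ℝ} (hs : s ∈ Icc t₀ T) (ht : t ∈ Icc t₀ T) :
    IntervalIntegrable (fun r => f r (γ r)) volume s t := by
  rw [intervalIntegrable_iff]
  exact IntegrableOn.mono_set (hf.integrable_comp hγ)
    (by rw [uIoc]; exact Ioc_subset_Ioc (le_inf hs.1 ht.1) (sup_le hs.2 ht.2))

end IsCaratheodory

theorem ae_restrict_uIoc_of_timeMeasure {t₀ T s t : ℝ} {p : ℝ → Prop}
    (h : ∀ᵐ r ∂timeMeasure t₀ T, p r) (hs : s ∈ Icc t₀ T) (ht : t ∈ Icc t₀ T) :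
    ∀ᵐ r ∂volume.restrict (uIoc s t), p r :=
  ae_restrict_of_ae_restrict_of_subset
    (by rw [uIoc]; exact Ioc_subset_Ioc (le_inf hs.1 ht.1) (sup_le hs.2 ht.2)) h

namespace IsSolution

variable {f g : ℝ → Euc d → Euc d} {t₀ T K s : ℝ} {x y : Euc d} {γ η : ℝ → Euc d}

theorem intervalIntegrable' (h : IsSolution f t₀ T s x γ) {a b : ℝ} (ha : a ∈ Icc t₀ T)
    (hb : b ∈ Icc t₀ T) : IntervalIntegrable (fun r => f r (γ r)) volume a b := by
  refine h.intervalIntegrable.mono_set (uIcc_subset_uIcc ?_ ?_) <;>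
  · rw [uIcc_of_le (ha.1.trans ha.2)]; assumption

theorem apply_self (h : IsSolution f t₀ T s x γ) (hs : s ∈ Icc t₀ T) : γ s = x := by
  rw [h.integral_eq s hs, intervalIntegral.integral_same, add_zero]

/-- Combined with uniqueness, this yields the cocycle property of the flow. -/
theorem rebase (h : IsSolution f t₀ T s x γ) (hs : s ∈ Icc t₀ T) {r : ℝ} (hr : r ∈ Icc t₀ T) :
    IsSolution f t₀ T r (γ r) γ where
  continuousOn := h.continuousOn
  intervalIntegrable := h.intervalIntegrable
  integral_eq t ht := by
    rw [h.integral_eq t ht, h.integral_eq r hr, add_assoc,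
      intervalIntegral.integral_add_adjacent_intervals (h.intervalIntegrable' hs hr)
        (h.intervalIntegrable' hr ht)]

/-- Stability of Carathéodory solutions with respect to data. -/
theorem norm_sub_le (hK : 0 ≤ K)
    (hf : ∀ᵐ r ∂timeMeasure t₀ T, ∀ x y, ‖f r x - f r y‖ ≤ K * ‖x - y‖)
    (hs : s ∈ Icc t₀ T) (h₁ : IsSolution f t₀ T s x γ) (h₂ : IsSolution g t₀ T s y η) {ε : ℝ}
    (hε : 0 ≤ ε) (hfg : ∀ᵐ r ∂timeMeasure t₀ T, ‖f r (η r) - g r (η r)‖ ≤ ε) :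
    ∀ t ∈ Icc t₀ T, ‖γ t - η t‖ ≤ (‖x - y‖ + ε * (T - t₀)) * Real.exp (K * |t - s|) := by
  have hcont : ContinuousOn (fun t => ‖γ t - η t‖) (Icc t₀ T) :=
    (h₁.continuousOn.sub h₂.continuousOn).norm
  refine le_mul_exp_abs_of_le_add_mul_abs_integral hK hcont (fun t => norm_nonneg _) hs ?_
  intro t ht
  have hci : IntervalIntegrable (fun r => ‖γ r - η r‖) volume s t :=
    (hcont.mono (by
      rw [uIcc]; exact Icc_subset_Icc (le_inf hs.1 ht.1) (sup_le hs.2 ht.2))).intervalIntegrable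
  -- The integrand splits at f(r, η): only `f` has to be Lipschitz, and the defect between the
  -- fields is measured only along η.
  have h1 : γ t - η t = (x - y) + ∫ r in s..t, (f r (γ r) - g r (η r)) := by
    rw [h₁.integral_eq t ht, h₂.integral_eq t ht, intervalIntegral.integral_sub
      (h₁.intervalIntegrable' hs ht) (h₂.intervalIntegrable' hs ht)]
    abel
  have h2 : ‖∫ r in s..t, (f r (γ r) - g r (η r))‖ ≤ |∫ r in s..t, (K * ‖γ r - η r‖ + ε)| := by
    refine intervalIntegral.norm_integral_le_abs_of_norm_le ?_
      ((hci.const_mul K).add intervalIntegrable_const)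
    filter_upwards [ae_restrict_uIoc_of_timeMeasure hf hs ht,
      ae_restrict_uIoc_of_timeMeasure hfg hs ht] with r hr1 hr2
    calc ‖f r (γ r) - g r (η r)‖ = ‖(f r (γ r) - f r (η r)) + (f r (η r) - g r (η r))‖ := by
          rw [sub_add_sub_cancel]
      _ ≤ _ := (norm_add_le _ _).trans (add_le_add (hr1 _ _) hr2)
  rw [intervalIntegral.integral_add (hci.const_mul K) intervalIntegrable_const,
    intervalIntegral.integral_const_mul, intervalIntegral.integral_const, smul_eq_mul] at h2
  have h3 : |t - s| ≤ T - t₀ := abs_sub_le_iff.2 ⟨by linarith [ht.2, hs.1], by linarith [hs.2, ht.1]⟩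
  calc ‖γ t - η t‖ ≤ ‖x - y‖ + |K * (∫ r in s..t, ‖γ r - η r‖) + (t - s) * ε| := by
        rw [h1]; exact (norm_add_le _ _).trans (add_le_add le_rfl h2)
    _ ≤ ‖x - y‖ + (K * |∫ r in s..t, ‖γ r - η r‖| + |t - s| * ε) := by
        gcongr
        refine (abs_add_le _ _).trans ?_
        rw [abs_mul, abs_mul, abs_of_nonneg hK, abs_of_nonneg hε]
    _ ≤ ‖x - y‖ + ε * (T - t₀) + K * |∫ r in s..t, ‖γ r - η r‖| := by nlinarith

theorem eqOn (hf : IsCaratheodory f t₀ T K) (hs : s ∈ Icc t₀ T) (h₁ : IsSolution f t₀ T s x γ)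
    (h₂ : IsSolution f t₀ T s x η) : EqOn γ η (Icc t₀ T) := by
  intro t ht
  have := norm_sub_le hf.nonneg hf.lipschitz hs h₁ h₂ le_rfl (by simp) t ht
  simpa [sub_eq_zero] using this

end IsSolution

/-- Global existence for Carathéodory equations, Lipschitz in space. -/
theorem IsCaratheodory.exists_isSolution {f : ℝ → Euc d → Euc d} {t₀ T K s : ℝ}
    (hf : IsCaratheodory f t₀ T K) (hs : s ∈ Icc t₀ T) (x : Euc d) :
    ∃ γ, IsSolution f t₀ T s x γ := by
  have hle : t₀ ≤ T := hs.1.trans hs.2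
  set l : ℝ := 2 * K + 1 with hl
  have hK := hf.nonneg
  have hl0 : 0 < l := by positivity
  have hne : Nonempty (Icc t₀ T) := ⟨⟨s, hs⟩⟩
  -- The unknown β is the candidate solution divided by e^{l|r-s|}, so the sup norm of β is the
  -- weighted norm of γ. With l = 2K + 1 the contraction factor K/l is at most 1/2.
  let γ : C(Icc t₀ T, Euc d) → ℝ → Euc d := fun β r =>
    Real.exp (l * |r - s|) • IccExtend hle β r
  have hγ : ∀ β, Continuous (γ β) := fun β =>
    Continuous.smul (f := fun r : ℝ => Real.exp (l * |r - s|)) (by fun_prop)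
      (β.continuous.Icc_extend')
  have hγI : ∀ β {a b : ℝ}, a ∈ Icc t₀ T → b ∈ Icc t₀ T →
      IntervalIntegrable (fun r => f r (γ β r)) volume a b := fun β _ _ ha hb =>
    hf.intervalIntegrable_comp (hγ β).continuousOn ha hb
  let I : C(Icc t₀ T, Euc d) → ℝ → Euc d := fun β t => x + ∫ r in s..t, f r (γ β r)
  have hI : ∀ β, ContinuousOn (I β) (Icc t₀ T) := fun β => by
    have h1 := intervalIntegral.continuousOn_primitive_interval' (μ := volume)
      (hγI β (left_mem_Icc.2 hle) (right_mem_Icc.2 hle)) (by rwa [uIcc_of_le hle])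
    rw [uIcc_of_le hle] at h1
    exact continuousOn_const.add h1
  let Φ : C(Icc t₀ T, Euc d) → C(Icc t₀ T, Euc d) := fun β =>
    ⟨fun t => Real.exp (-(l * |(t : ℝ) - s|)) • I β t,
      Continuous.smul (f := fun t : Icc t₀ T => Real.exp (-(l * |(t : ℝ) - s|))) (by fun_prop)
        (hI β).domRestrict⟩
  have hcontr : ContractingWith (1 / 2) Φ := by
    refine ⟨by
      rw [← NNReal.coe_lt_coe]; norm_num, LipschitzWith.of_dist_le_mul fun β β' => ?_⟩
    rw [ContinuousMap.dist_le (by positivity)]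
    intro t
    have hts : (t : ℝ) ∈ Icc t₀ T := t.2
    have h1 : I β t - I β' t = ∫ r in s..t, (f r (γ β r) - f r (γ β' r)) := by
      simp only [I]
      rw [intervalIntegral.integral_sub (hγI β hs hts) (hγI β' hs hts)]
      abel
    have h2 : ‖I β t - I β' t‖ ≤ |∫ r in s..t, K * dist β β' * Real.exp (l * |r - s|)| := by
      rw [h1]
      have hcont : Continuous fun r => K * dist β β' * Real.exp (l * |r - s|) := by fun_prop
      refine intervalIntegral.norm_integral_le_abs_of_norm_le ?_ (hcont.intervalIntegrable _ _)
      filter_upwards [ae_restrict_uIoc_of_timeMeasure hf.lipschitz hs hts] with r hr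
      refine (hr _ _).trans ?_
      simp only [γ]
      rw [← smul_sub, norm_smul, Real.norm_of_nonneg (Real.exp_pos _).le]
      have h3 : ‖IccExtend hle β r - IccExtend hle β' r‖ ≤ dist β β' := by
        rw [← dist_eq_norm]; exact ContinuousMap.dist_apply_le_dist _
      calc K * (Real.exp (l * |r - s|) * ‖IccExtend hle β r - IccExtend hle β' r‖)
          ≤ K * (Real.exp (l * |r - s|) * dist β β') := by gcongr
        _ = _ := by ring
    rw [intervalIntegral.integral_const_mul, abs_mul,
      abs_of_nonneg (mul_nonneg hK dist_nonneg)] at h2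
    have h4 := abs_integral_exp_mul_abs_le hl0 s t
    have h5 : dist (Φ β t) (Φ β' t) = Real.exp (-(l * |(t : ℝ) - s|)) * ‖I β t - I β' t‖ := by
      rw [dist_eq_norm]
      simp only [Φ, ContinuousMap.coe_mk]
      rw [← smul_sub, norm_smul, Real.norm_of_nonneg (Real.exp_pos _).le]
    rw [h5]
    have hd : 0 ≤ dist β β' := dist_nonneg
    calc Real.exp (-(l * |(t : ℝ) - s|)) * ‖I β t - I β' t‖
        ≤ Real.exp (-(l * |(t : ℝ) - s|)) *
          (K * dist β β' * (Real.exp (l * |(t : ℝ) - s|) / l)) := by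
          gcongr; exact h2.trans (mul_le_mul_of_nonneg_left h4 (by positivity))
      _ = K / l * dist β β' := by
          rw [Real.exp_neg]; field_simp
      _ ≤ _ := by
          gcongr
          rw [div_le_iff₀ hl0, hl]; push_cast; linarith
  obtain ⟨β, hβ, -⟩ := hcontr.exists_fixedPoint (0 : C(Icc t₀ T, Euc d)) (edist_ne_top _ _)
  refine ⟨γ β, (hγ β).continuousOn, hγI β (left_mem_Icc.2 hle) (right_mem_Icc.2 hle), ?_⟩
  intro t ht
  have h1 : Φ β ⟨t, ht⟩ = β ⟨t, ht⟩ := by rw [hβ.eq]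
  have h2 : γ β t = Real.exp (l * |t - s|) • β ⟨t, ht⟩ := by
    simp only [γ]; rw [IccExtend_of_mem hle _ ht]
  rw [h2, ← h1]
  simp only [Φ, ContinuousMap.coe_mk]
  rw [smul_smul, ← Real.exp_add, add_neg_cancel, Real.exp_zero, one_smul]

theorem IsCaratheodory.isSolution_solution {f : ℝ → Euc d → Euc d} {t₀ T K s : ℝ}
    (hf : IsCaratheodory f t₀ T K) (hs : s ∈ Icc t₀ T) (x : Euc d) :
    IsSolution f t₀ T s x (solution f t₀ T s x) := by
  have h := hf.exists_isSolution hs x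
  rw [solution, dif_pos h]
  exact h.choose_spec

end Caratheodory

/-! ### The flow of the drift: dependence on initial data, variational equation, invertible
differential. -/

section Flow

open Filter Topology

variable {d : ℕ}

/-- A directional derivative is the limit of the difference quotients with step 1/n, so
measurability of the shifted compositions suffices. -/
theorem aestronglyMeasurable_fderiv_apply {α E F : Type*} [MeasurableSpace α] {μ : Measure α}
    [NormedAddCommGroup E] [NormedSpace ℝ E] [NormedAddCommGroup F] [NormedSpace ℝ F]
    {f : α → E → F} {γ : α → E} (hm : ∀ w, AEStronglyMeasurable (fun t => f t (γ t + w)) μ)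
    (hd : ∀ᵐ t ∂μ, DifferentiableAt ℝ (f t) (γ t)) (v : E) :
    AEStronglyMeasurable (fun t => fderiv ℝ (f t) (γ t) v) μ := by
  refine aestronglyMeasurable_of_tendsto_ae atTop
    (f := fun (n : ℕ) t => (n : ℝ) • (f t (γ t + (n : ℝ)⁻¹ • v) - f t (γ t)))
    (fun n => ((hm _).sub (by simpa using hm 0)).const_smul _) ?_
  filter_upwards [hd] with t ht
  exact ht.hasFDerivAt.lim v (by simpa using tendsto_natCast_atTop_atTop)

theorem aestronglyMeasurable_clm_of_apply {α F : Type*} [MeasurableSpace α] {μ : Measure α}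
    [NormedAddCommGroup F] [NormedSpace ℝ F] {A : α → Euc d →L[ℝ] F}
    (h : ∀ v, AEStronglyMeasurable (fun t => A t v) μ) : AEStronglyMeasurable A μ := by
  let b := EuclideanSpace.basisFun (Fin d) ℝ
  have hA : A = fun t => ∑ i, ContinuousLinearMap.smulRightL ℝ (Euc d) F (innerSL ℝ (b i))
      (A t (b i)) := by
    funext t
    ext v
    conv_lhs => rw [← b.sum_repr' v]
    simp
  rw [hA]
  exact Finset.aestronglyMeasurable_fun_sum _ fun i _ =>
    (ContinuousLinearMap.continuous _).comp_aestronglyMeasurable (h (b i))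

theorem norm_sub_le_of_norm_fderiv_le {E F : Type*} [NormedAddCommGroup E] [NormedSpace ℝ E]
    [NormedAddCommGroup F] [NormedSpace ℝ F] {f : E → F} {C : ℝ} (hf : Differentiable ℝ f)
    (hC : ∀ x, ‖fderiv ℝ f x‖ ≤ C) (x y : E) : ‖f x - f y‖ ≤ C * ‖x - y‖ :=
  convex_univ.norm_image_sub_le_of_norm_fderiv_le (fun z _ => hf z) (fun z _ => hC z)
    (mem_univ y) (mem_univ x)

/-- The right-hand side of the variational equation along the flow line of `x`. -/
noncomputable def variationalField (N : ℝ → Euc d → Euc d) (t₀ T s : ℝ) (x : Euc d) (r : ℝ)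
    (w : Euc d) : Euc d :=
  fderiv ℝ (N r) (flow N t₀ T s r x) w

namespace DriftAssumption

variable {N : ℝ → Euc d → Euc d} {t₀ T Λ₁ Λ₂ : ℝ} (hN : DriftAssumption N t₀ T Λ₁ Λ₂)

include hN

theorem norm_sub_le {t : ℝ} (ht : t ∈ Icc t₀ T) (x y : Euc d) :
    ‖N t x - N t y‖ ≤ Λ₁ * ‖x - y‖ :=
  norm_sub_le_of_norm_fderiv_le ((hN.contDiff t ht).differentiable two_ne_zero)
    (hN.fderiv_le t ht) x y

theorem isCaratheodory : IsCaratheodory N t₀ T Λ₁ where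
  nonneg := hN.lipschitz_pos.le
  lipschitz := by
    filter_upwards [ae_restrict_mem measurableSet_Ioc] with t ht
    exact hN.norm_sub_le (Ioc_subset_Icc_self ht)
  integrable x := (hN.memLp_time x).integrable le_top

theorem norm_fderiv_sub_le {t : ℝ} (ht : t ∈ Icc t₀ T) (x y : Euc d) :
    ‖fderiv ℝ (N t) x - fderiv ℝ (N t) y‖ ≤ Λ₂ * ‖x - y‖ :=
  norm_sub_le_of_norm_fderiv_le
    (((hN.contDiff t ht).fderiv_right (m := 1) (by norm_num)).differentiable one_ne_zero)
    (hN.second_fderiv_le t ht) x y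

/-- Mean value inequality for N_t minus its linearization on the ball of radius |w|, where DN_t
varies by at most Λ₂|w|. The sharper factor 1/2 is not needed. -/
theorem norm_add_sub_sub_fderiv_le {t : ℝ} (ht : t ∈ Icc t₀ T) (x w : Euc d) :
    ‖fderiv ℝ (N t) x w - (N t (x + w) - N t x)‖ ≤ Λ₂ * ‖w‖ ^ 2 := by
  have hd := (hN.contDiff t ht).differentiable two_ne_zero
  have h := (convex_closedBall x ‖w‖).norm_image_sub_le_of_norm_hasFDerivWithin_le'
    (f := N t) (f' := fun z => fderiv ℝ (N t) z) (φ := fderiv ℝ (N t) x) (C := Λ₂ * ‖w‖)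
    (fun z _ => (hd z).hasFDerivAt.hasFDerivWithinAt)
    (fun z hz => (hN.norm_fderiv_sub_le ht z x).trans (by
      have := hN.second_pos
      rw [mem_closedBall_iff_norm] at hz
      gcongr))
    (Metric.mem_closedBall_self (norm_nonneg _)) (y := x + w) (by simp)
  rw [norm_sub_rev]
  simpa [pow_two, mul_assoc] using h

theorem isSolution_flow {s : ℝ} (hs : s ∈ Icc t₀ T) (x : Euc d) :
    IsSolution N t₀ T s x (fun t => flow N t₀ T s t x) :=
  hN.isCaratheodory.isSolution_solution hs x

theorem flow_self {s : ℝ} (hs : s ∈ Icc t₀ T) (x : Euc d) : flow N t₀ T s s x = x :=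
  (hN.isSolution_flow hs x).apply_self hs

/-- A solution of the drift equation is transported by the flow. -/
theorem flow_apply_solution {s t r : ℝ} (hs : s ∈ Icc t₀ T) (ht : t ∈ Icc t₀ T)
    (hr : r ∈ Icc t₀ T) {x : Euc d} {γ : ℝ → Euc d} (hγ : IsSolution N t₀ T s x γ) :
    flow N t₀ T t r (γ t) = γ r :=
  (hN.isSolution_flow ht (γ t)).eqOn hN.isCaratheodory ht (hγ.rebase hs ht) hr

theorem flow_flow {s t r : ℝ} (hs : s ∈ Icc t₀ T) (ht : t ∈ Icc t₀ T)
    (hr : r ∈ Icc t₀ T) (x : Euc d) :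
    flow N t₀ T t r (flow N t₀ T s t x) = flow N t₀ T s r x :=
  hN.flow_apply_solution hs ht hr (hN.isSolution_flow hs x)

theorem exp_le {s t : ℝ} (hs : s ∈ Icc t₀ T) (ht : t ∈ Icc t₀ T) :
    Real.exp (Λ₁ * |t - s|) ≤ Real.exp (Λ₁ * (T - t₀)) := by
  have := hN.lipschitz_pos
  gcongr
  exact abs_sub_le_iff.2 ⟨by linarith [ht.2, hs.1], by linarith [hs.2, ht.1]⟩

theorem norm_flow_sub_le {s t : ℝ} (hs : s ∈ Icc t₀ T) (ht : t ∈ Icc t₀ T) (x y : Euc d) :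
    ‖flow N t₀ T s t x - flow N t₀ T s t y‖ ≤ Real.exp (Λ₁ * (T - t₀)) * ‖x - y‖ := by
  have h := IsSolution.norm_sub_le hN.isCaratheodory.nonneg hN.isCaratheodory.lipschitz hs
    (hN.isSolution_flow hs x) (hN.isSolution_flow hs y) le_rfl (by simp) t ht
  rw [zero_mul, add_zero, mul_comm] at h
  exact h.trans (mul_le_mul_of_nonneg_right (hN.exp_le hs ht) (norm_nonneg _))

/-- By the cocycle property Φ_{s,r}(x) = Φ_{t,r}(Φ_{s,t}(x)), so changing the initial time from s to
t only moves the initial point from Φ_{s,t}(x) to x. This is the source of measurability of the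
kernel in its initial time. -/
theorem continuousOn_flow_left {r : ℝ} (hr : r ∈ Icc t₀ T) (x : Euc d) :
    ContinuousOn (fun s => flow N t₀ T s r x) (Icc t₀ T) := by
  intro s hs
  have hcont : Tendsto (fun t => Real.exp (Λ₁ * (T - t₀)) * ‖x - flow N t₀ T s t x‖)
      (𝓝[Icc t₀ T] s) (𝓝 0) := by
    have h1 := ((continuousOn_const (c := x)).sub (hN.isSolution_flow hs x).continuousOn).norm s hs
    have h2 : ‖x - flow N t₀ T s s x‖ = 0 := by rw [hN.flow_self hs, sub_self, norm_zero]
    have h3 := h1.tendsto.const_mul (Real.exp (Λ₁ * (T - t₀)))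
    simp only [Pi.sub_apply, h2, mul_zero] at h3
    exact h3
  refine tendsto_iff_norm_sub_tendsto_zero.2
    (squeeze_zero' (Eventually.of_forall fun _ => norm_nonneg _) ?_ hcont)
  filter_upwards [self_mem_nhdsWithin] with t ht
  have h := hN.norm_flow_sub_le ht hr x (flow N t₀ T s t x)
  rwa [hN.flow_flow hs ht hr] at h

theorem isCaratheodory_variationalField {s : ℝ} (hs : s ∈ Icc t₀ T) (x : Euc d) :
    IsCaratheodory (variationalField N t₀ T s x) t₀ T Λ₁ where
  nonneg := hN.lipschitz_pos.le
  lipschitz := by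
    filter_upwards [ae_restrict_mem measurableSet_Ioc] with t ht y z
    rw [variationalField, variationalField, ← map_sub]
    exact ContinuousLinearMap.le_of_opNorm_le _ (hN.fderiv_le t (Ioc_subset_Icc_self ht) _) _
  integrable w := by
    refine Integrable.of_bound (C := Λ₁ * ‖w‖)
      (aestronglyMeasurable_fderiv_apply (fun v => ?_) ?_ w) ?_
    · exact (hN.isCaratheodory.integrable_comp
        ((hN.isSolution_flow hs x).continuousOn.add continuousOn_const)).aestronglyMeasurable
    · filter_upwards [ae_restrict_mem measurableSet_Ioc] with t ht
      exact (hN.contDiff t (Ioc_subset_Icc_self ht)).differentiable two_ne_zero _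
    · filter_upwards [ae_restrict_mem measurableSet_Ioc] with t ht
      exact ContinuousLinearMap.le_of_opNorm_le _ (hN.fderiv_le t (Ioc_subset_Icc_self ht) _) _

/-- The flow is differentiable in space, and its differential solves the variational equation. -/
theorem hasFDerivAt_flow {s t : ℝ} (hs : s ∈ Icc t₀ T) (ht : t ∈ Icc t₀ T) (x : Euc d) :
    ∃ Y : Euc d →L[ℝ] Euc d, HasFDerivAt (flow N t₀ T s t) Y x ∧
      ∀ v, Y v = solution (variationalField N t₀ T s x) t₀ T s v t := by
  set A := variationalField N t₀ T s x with hA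
  have hAc := hN.isCaratheodory_variationalField hs x
  have hsol := fun v => hAc.isSolution_solution hs v
  -- Linearity in the initial vector is uniqueness for the linear variational equation.
  let Yl : Euc d →ₗ[ℝ] Euc d :=
    { toFun := fun v => solution A t₀ T s v t
      map_add' := fun v w => by
        refine (hsol (v + w)).eqOn (η := fun r => solution A t₀ T s v r + solution A t₀ T s w r)
          hAc hs ⟨(hsol v).continuousOn.add (hsol w).continuousOn, ?_, fun r hr => ?_⟩ ht
        · simpa only [hA, variationalField, map_add] using
            (hsol v).intervalIntegrable.add (hsol w).intervalIntegrable
        · rw [(hsol v).integral_eq r hr, (hsol w).integral_eq r hr, add_add_add_comm,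
            ← intervalIntegral.integral_add ((hsol v).intervalIntegrable' hs hr)
              ((hsol w).intervalIntegrable' hs hr)]
          simp only [hA, variationalField, map_add]
      map_smul' := fun c v => by
        refine (hsol (c • v)).eqOn (η := fun r => c • solution A t₀ T s v r)
          hAc hs ⟨(hsol v).continuousOn.const_smul c, ?_, fun r hr => ?_⟩ ht
        · have h1 : (fun r => A r (c • solution A t₀ T s v r)) =
              fun r => c • A r (solution A t₀ T s v r) := by
            simp only [hA, variationalField, map_smul]
          rw [h1]
          exact (hsol v).intervalIntegrable.smul c
        · rw [(hsol v).integral_eq r hr, smul_add, ← intervalIntegral.integral_smul]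
          simp only [hA, variationalField, map_smul] }
  refine ⟨LinearMap.toContinuousLinearMap Yl, ?_, fun v => rfl⟩
  set E := Real.exp (Λ₁ * (T - t₀)) with hE
  have hE0 : 0 < E := Real.exp_pos _
  have hΔ : 0 ≤ T - t₀ := by linarith [hs.1, hs.2]
  have hΛ₂ := hN.second_pos
  have hbound : ∀ h : Euc d, ‖flow N t₀ T s t (x + h) - flow N t₀ T s t x - Yl h‖
      ≤ (Λ₂ * E ^ 2 * (T - t₀) * E) * ‖h‖ ^ 2 := by
    intro h
    have h1 := hN.isSolution_flow hs (x + h)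
    have h2 := hN.isSolution_flow hs x
    -- The increment of the flow solves its own ODE with initial value h. Stability against the
    -- variational equation leaves a defect Λ₂(E|h|)², quadratic in h.
    have h3 : IsSolution (fun r w => N r (flow N t₀ T s r x + w) - N r (flow N t₀ T s r x)) t₀ T s h
        (fun r => flow N t₀ T s r (x + h) - flow N t₀ T s r x) := by
      refine ⟨h1.continuousOn.sub h2.continuousOn, ?_, fun r hr => ?_⟩
      · simpa only [add_sub_cancel] using h1.intervalIntegrable.sub h2.intervalIntegrable
      · have h4 := h1.integral_eq r hr
        have h5 := h2.integral_eq r hr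
        simp only [add_sub_cancel]
        rw [intervalIntegral.integral_sub (h1.intervalIntegrable' hs hr)
          (h2.intervalIntegrable' hs hr), h4, h5]
        abel
    have h4 := IsSolution.norm_sub_le hAc.nonneg hAc.lipschitz hs (hsol h) h3
      (ε := Λ₂ * (E * ‖h‖) ^ 2) (by positivity) (by
        filter_upwards [ae_restrict_mem measurableSet_Ioc] with r hr
        refine (hN.norm_add_sub_sub_fderiv_le (Ioc_subset_Icc_self hr) _ _).trans ?_
        have := hN.norm_flow_sub_le hs (Ioc_subset_Icc_self hr) (x + h) x
        rw [add_sub_cancel_left] at this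
        gcongr) t ht
    rw [norm_sub_rev, sub_self, norm_zero, zero_add] at h4
    refine h4.trans ?_
    calc _ ≤ Λ₂ * (E * ‖h‖) ^ 2 * (T - t₀) * E := by gcongr; exact hN.exp_le hs ht
      _ = _ := by ring
  rw [hasFDerivAt_iff_isLittleO_nhds_zero]
  refine Asymptotics.IsBigO.trans_isLittleO (g := fun h : Euc d => ‖h‖ ^ 2)
    (Asymptotics.IsBigO.of_bound (Λ₂ * E ^ 2 * (T - t₀) * E) (Eventually.of_forall fun h => ?_))
    (Asymptotics.isLittleO_norm_pow_id one_lt_two)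
  rw [Real.norm_of_nonneg (by positivity : (0 : ℝ) ≤ ‖h‖ ^ 2)]
  exact hbound h

theorem differentiable_flow {s t : ℝ} (hs : s ∈ Icc t₀ T) (ht : t ∈ Icc t₀ T) :
    Differentiable ℝ (flow N t₀ T s t) := fun x =>
  let ⟨_, hY, _⟩ := hN.hasFDerivAt_flow hs ht x
  hY.differentiableAt

theorem fderiv_flow_apply {s t : ℝ} (hs : s ∈ Icc t₀ T) (ht : t ∈ Icc t₀ T) (x v : Euc d) :
    fderiv ℝ (flow N t₀ T s t) x v = solution (variationalField N t₀ T s x) t₀ T s v t := by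
  obtain ⟨Y, hY, hv⟩ := hN.hasFDerivAt_flow hs ht x
  rw [hY.fderiv, hv]

theorem norm_fderiv_flow_le {s t : ℝ} (hs : s ∈ Icc t₀ T) (ht : t ∈ Icc t₀ T) (x : Euc d) :
    ‖fderiv ℝ (flow N t₀ T s t) x‖ ≤ Real.exp (Λ₁ * (T - t₀)) := by
  have h := norm_fderiv_le_of_lipschitz ℝ (x₀ := x)
    (LipschitzWith.of_dist_le' (K := Real.exp (Λ₁ * (T - t₀))) (f := flow N t₀ T s t) fun x y => by
      simpa only [dist_eq_norm] using hN.norm_flow_sub_le hs ht x y)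
  rwa [Real.coe_toNNReal _ (Real.exp_pos _).le] at h

/-- The differential of the flow is Lipschitz in space, uniformly in time. -/
theorem norm_fderiv_flow_sub_le {s t : ℝ} (hs : s ∈ Icc t₀ T) (ht : t ∈ Icc t₀ T) (x y : Euc d) :
    ‖fderiv ℝ (flow N t₀ T s t) x - fderiv ℝ (flow N t₀ T s t) y‖ ≤
      Λ₂ * (T - t₀) * Real.exp (Λ₁ * (T - t₀)) ^ 3 * ‖x - y‖ := by
  set E := Real.exp (Λ₁ * (T - t₀)) with hE
  have hE0 : 0 < E := Real.exp_pos _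
  have hΔ : 0 ≤ T - t₀ := by linarith [hs.1, hs.2]
  have hΛ₂ := hN.second_pos
  refine ContinuousLinearMap.opNorm_le_bound _ (by positivity) fun v => ?_
  rw [_root_.sub_apply, hN.fderiv_flow_apply hs ht, hN.fderiv_flow_apply hs ht]
  have hx := hN.isCaratheodory_variationalField hs x
  have hy := hN.isCaratheodory_variationalField hs y
  have h := IsSolution.norm_sub_le hx.nonneg hx.lipschitz hs (hx.isSolution_solution hs v)
    (hy.isSolution_solution hs v) (ε := Λ₂ * (E * ‖x - y‖) * (E * ‖v‖)) (by positivity) (by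
      filter_upwards [ae_restrict_mem measurableSet_Ioc] with r hr
      have hr' := Ioc_subset_Icc_self hr
      rw [variationalField, variationalField, ← _root_.sub_apply,
        ← hN.fderiv_flow_apply hs hr']
      have h1 := hN.norm_flow_sub_le hs hr' x y
      have h2 := ContinuousLinearMap.le_of_opNorm_le _ (hN.norm_fderiv_flow_le hs hr' y) v
      refine (ContinuousLinearMap.le_opNorm _ _).trans ?_
      gcongr
      exact (hN.norm_fderiv_sub_le hr' _ _).trans (by gcongr)) t ht
  rw [sub_self, norm_zero, zero_add] at h
  refine h.trans ?_
  calc _ ≤ Λ₂ * (E * ‖x - y‖) * (E * ‖v‖) * (T - t₀) * E := by gcongr; exact hN.exp_le hs ht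
    _ = _ := by ring

theorem aestronglyMeasurable_fderiv_flow {r : ℝ} (hr : r ∈ Icc t₀ T) (x : Euc d) :
    AEStronglyMeasurable (fun t => fderiv ℝ (flow N t₀ T t r) x) (timeMeasure t₀ T) := by
  refine aestronglyMeasurable_clm_of_apply fun v => aestronglyMeasurable_fderiv_apply
    (f := fun t => flow N t₀ T t r) (γ := fun _ => x) (fun w => ?_) ?_ v
  · exact (hN.continuousOn_flow_left hr (x + w)).aestronglyMeasurable_timeMeasure
  · filter_upwards [ae_restrict_mem measurableSet_Ioc] with t ht
    exact hN.differentiable_flow (Ioc_subset_Icc_self ht) hr x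

theorem fderiv_flow_comp {s t r : ℝ} (hs : s ∈ Icc t₀ T) (ht : t ∈ Icc t₀ T)
    (hr : r ∈ Icc t₀ T) (x : Euc d) :
    fderiv ℝ (flow N t₀ T s r) x =
      (fderiv ℝ (flow N t₀ T t r) (flow N t₀ T s t x)).comp (fderiv ℝ (flow N t₀ T s t) x) := by
  have h : flow N t₀ T s r = flow N t₀ T t r ∘ flow N t₀ T s t :=
    funext fun z => (hN.flow_flow hs ht hr z).symm
  rw [h, fderiv_comp x (hN.differentiable_flow ht hr _) (hN.differentiable_flow hs ht _)]

/-- The differential of the backward flow is the inverse, by the chain rule applied to both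
compositions with the forward flow. -/
theorem isUnit_fderiv_flow {s t : ℝ} (hs : s ∈ Icc t₀ T) (ht : t ∈ Icc t₀ T) (x : Euc d) :
    IsUnit (fderiv ℝ (flow N t₀ T s t) x) := by
  have hid : ∀ {a : ℝ}, a ∈ Icc t₀ T → ∀ z, fderiv ℝ (flow N t₀ T a a) z = 1 := fun {a} ha z => by
    have h : flow N t₀ T a a = fun z => z := funext fun z => hN.flow_self ha z
    rw [h]; exact fderiv_fun_id
  have h1 := hN.fderiv_flow_comp hs ht hs x
  have h2 := hN.fderiv_flow_comp ht hs ht (flow N t₀ T s t x)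
  rw [hid hs] at h1
  rw [hid ht, hN.flow_flow hs ht hs, hN.flow_self hs] at h2
  exact ⟨⟨_, _, h2.symm, h1.symm⟩, rfl⟩

end DriftAssumption

end Flow

/-! ### Controlled trajectories, the kernel DΦ·B and the Gramian. -/

section Control

open Filter Topology

variable {d k : ℕ}

theorem norm_ae_le_toReal_eLpNorm_top {α F : Type*} [MeasurableSpace α] {μ : Measure α}
    [NormedAddCommGroup F] {f : α → F} (hf : MemLp f ∞ μ) :
    ∀ᵐ t ∂μ, ‖f t‖ ≤ (eLpNorm f ∞ μ).toReal := by
  have h : ∀ᵐ t ∂μ, ‖f t‖ₑ ≤ eLpNorm f ∞ μ := by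
    rw [eLpNorm_exponent_top]; exact ae_le_eLpNormEssSup
  filter_upwards [h] with t ht
  rw [← toReal_enorm]
  exact ENNReal.toReal_mono hf.eLpNorm_ne_top ht

theorem Control.ae_norm_le {t₀ T : ℝ} (u : Control k t₀ T) :
    ∀ᵐ t ∂timeMeasure t₀ T, ‖u t‖ ≤ ‖u‖ :=
  norm_ae_le_toReal_eLpNorm_top (Lp.memLp u)

theorem Control.norm_le_of_ae_norm_le {t₀ T : ℝ} {u : Control k t₀ T} {c : ℝ} (hc : 0 ≤ c)
    (h : ∀ᵐ t ∂timeMeasure t₀ T, ‖u t‖ ≤ c) : ‖u‖ ≤ c := by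
  simpa using Lp.norm_le_of_ae_bound hc h

theorem norm_adjoint_sub {m n : ℕ} (A B : Euc m →L[ℝ] Euc n) :
    ‖ContinuousLinearMap.adjoint A - ContinuousLinearMap.adjoint B‖ = ‖A - B‖ := by
  rw [← map_sub, LinearIsometryEquiv.norm_map]

theorem norm_adjoint {m n : ℕ} (A : Euc m →L[ℝ] Euc n) :
    ‖ContinuousLinearMap.adjoint A‖ = ‖A‖ := LinearIsometryEquiv.norm_map _ A

theorem inputNorm_nonneg (B : ℝ → Euc d → (Euc k →L[ℝ] Euc d)) (t₀ T : ℝ) :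
    0 ≤ inputNorm B t₀ T := ENNReal.toReal_nonneg

namespace InputAssumption

variable {B : ℝ → Euc d → (Euc k →L[ℝ] Euc d)} {t₀ T LB : ℝ}

theorem norm_sub_le (hB : InputAssumption B t₀ T LB) {t : ℝ} (ht : t ∈ Icc t₀ T) (x y : Euc d) :
    ‖B t x - B t y‖ ≤ LB * ‖x - y‖ :=
  norm_sub_le_of_norm_fderiv_le ((hB.contDiff t ht).differentiable one_ne_zero)
    (hB.fderiv_le t ht) x y

/-- The essential bound on `B` holds for almost every time and *every* state. -/
theorem ae_norm_le (hB : InputAssumption B t₀ T LB) :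
    ∀ᵐ t ∂timeMeasure t₀ T, ∀ x, ‖B t x‖ ≤ inputNorm B t₀ T := by
  -- Fubini gives the bound for almost every x only, whereas a trajectory may run inside a null set
  -- of space-time. A set of full measure is dense, and continuity in x extends the bound to every
  -- x.
  filter_upwards [Measure.ae_ae_of_ae_prod (norm_ae_le_toReal_eLpNorm_top hB.memLp),
    ae_restrict_mem measurableSet_Ioc] with t ht htI
  have hcont := (hB.contDiff t (Ioc_subset_Icc_self htI)).continuous
  have hclosed : IsClosed {x | ‖B t x‖ ≤ inputNorm B t₀ T} :=
    isClosed_le hcont.norm continuous_const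
  intro x
  have h : closure {x | ‖B t x‖ ≤ inputNorm B t₀ T} = univ := (Measure.dense_of_ae ht).closure_eq
  rw [hclosed.closure_eq] at h
  exact h.symm.subset (mem_univ x)

/-- Joint measurability only gives measurable time slices for almost every state; an arbitrary state
is a limit of such states, and B(t, ·) is continuous. -/
theorem aestronglyMeasurable (hB : InputAssumption B t₀ T LB) (x : Euc d) :
    AEStronglyMeasurable (fun t => B t x) (timeMeasure t₀ T) := by
  have h1 : ∀ᵐ z ∂(volume : Measure (Euc d)),
      AEStronglyMeasurable (fun t => B t z) (timeMeasure t₀ T) :=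
    hB.memLp.aestronglyMeasurable.prod_swap.prodMk_left
  obtain ⟨z, hz, hzx⟩ := mem_closure_iff_seq_limit.1 ((Measure.dense_of_ae h1) x)
  refine aestronglyMeasurable_of_tendsto_ae atTop (f := fun n t => B t (z n)) hz ?_
  filter_upwards [ae_restrict_mem measurableSet_Ioc] with t ht
  exact ((hB.contDiff t (Ioc_subset_Icc_self ht)).continuous.tendsto x).comp hzx

end InputAssumption

/-- The kernel `(t, x) ↦ DΦ_{t,τ}(x) B(t, x)`. -/
noncomputable def kernelField (N : ℝ → Euc d → Euc d) (B : ℝ → Euc d → (Euc k →L[ℝ] Euc d))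
    (t₀ T τ t : ℝ) (x : Euc d) : Euc k →L[ℝ] Euc d :=
  (fderiv ℝ (flow N t₀ T t τ) x).comp (B t x)

/-- The bound on `kernelField`. -/
noncomputable def kernelBound (B : ℝ → Euc d → (Euc k →L[ℝ] Euc d)) (t₀ T Λ₁ : ℝ) : ℝ :=
  Real.exp (Λ₁ * (T - t₀)) * inputNorm B t₀ T

/-- The Lipschitz constant of `kernelField` in space. -/
noncomputable def kernelLip (B : ℝ → Euc d → (Euc k →L[ℝ] Euc d)) (t₀ T Λ₁ Λ₂ LB : ℝ) : ℝ :=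
  Λ₂ * (T - t₀) * Real.exp (Λ₁ * (T - t₀)) ^ 3 * inputNorm B t₀ T +
    Real.exp (Λ₁ * (T - t₀)) * LB

section Kernel

variable {N : ℝ → Euc d → Euc d} {B : ℝ → Euc d → (Euc k →L[ℝ] Euc d)} {t₀ T Λ₁ Λ₂ LB τ : ℝ}

theorem kernelBound_nonneg : 0 ≤ kernelBound B t₀ T Λ₁ :=
  mul_nonneg (Real.exp_pos _).le (inputNorm_nonneg B t₀ T)

theorem kernelLip_nonneg (hN : DriftAssumption N t₀ T Λ₁ Λ₂) (hB : InputAssumption B t₀ T LB)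
    (hT : t₀ < T) : 0 ≤ kernelLip B t₀ T Λ₁ Λ₂ LB := by
  have h1 := hN.second_pos
  have h2 := hB.bound_nonneg
  have h3 := inputNorm_nonneg B t₀ T
  have h4 : 0 < T - t₀ := sub_pos.2 hT
  unfold kernelLip
  positivity

theorem ae_norm_kernelField_le (hN : DriftAssumption N t₀ T Λ₁ Λ₂)
    (hB : InputAssumption B t₀ T LB) (hτ : τ ∈ Icc t₀ T) :
    ∀ᵐ t ∂timeMeasure t₀ T, ∀ x, ‖kernelField N B t₀ T τ t x‖ ≤ kernelBound B t₀ T Λ₁ := by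
  filter_upwards [hB.ae_norm_le, ae_restrict_mem measurableSet_Ioc] with t ht htI x
  refine (ContinuousLinearMap.opNorm_comp_le _ _).trans ?_
  exact mul_le_mul (hN.norm_fderiv_flow_le (Ioc_subset_Icc_self htI) hτ x) (ht x)
    (norm_nonneg _) (Real.exp_pos _).le

theorem ae_norm_kernelField_sub_le (hN : DriftAssumption N t₀ T Λ₁ Λ₂)
    (hB : InputAssumption B t₀ T LB) (hτ : τ ∈ Icc t₀ T) :
    ∀ᵐ t ∂timeMeasure t₀ T, ∀ x y, ‖kernelField N B t₀ T τ t x - kernelField N B t₀ T τ t y‖ ≤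
      kernelLip B t₀ T Λ₁ Λ₂ LB * ‖x - y‖ := by
  filter_upwards [hB.ae_norm_le, ae_restrict_mem measurableSet_Ioc] with t ht htI x y
  have htI' := Ioc_subset_Icc_self htI
  have h1 : kernelField N B t₀ T τ t x - kernelField N B t₀ T τ t y =
      (fderiv ℝ (flow N t₀ T t τ) x - fderiv ℝ (flow N t₀ T t τ) y).comp (B t x) +
        (fderiv ℝ (flow N t₀ T t τ) y).comp (B t x - B t y) := by
    ext v; simp [kernelField]
  rw [h1]
  have h2 := hN.norm_fderiv_flow_sub_le htI' hτ x y
  calc _ ≤ Λ₂ * (T - t₀) * Real.exp (Λ₁ * (T - t₀)) ^ 3 * ‖x - y‖ * inputNorm B t₀ T +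
        Real.exp (Λ₁ * (T - t₀)) * (LB * ‖x - y‖) := by
        refine (norm_add_le _ _).trans (add_le_add ?_ ?_)
        · exact (ContinuousLinearMap.opNorm_comp_le _ _).trans
            (mul_le_mul h2 (ht x) (norm_nonneg _) ((norm_nonneg _).trans h2))
        · exact (ContinuousLinearMap.opNorm_comp_le _ _).trans
            (mul_le_mul (hN.norm_fderiv_flow_le htI' hτ y) (hB.norm_sub_le htI' x y)
              (norm_nonneg _) (Real.exp_pos _).le)
    _ = _ := by rw [kernelLip]; ring

theorem aestronglyMeasurable_kernelField (hN : DriftAssumption N t₀ T Λ₁ Λ₂)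
    (hB : InputAssumption B t₀ T LB) (hτ : τ ∈ Icc t₀ T) {γ : ℝ → Euc d}
    (hγ : ContinuousOn γ (Icc t₀ T)) :
    AEStronglyMeasurable (fun t => kernelField N B t₀ T τ t (γ t)) (timeMeasure t₀ T) := by
  refine aestronglyMeasurable_comp_of_caratheodory
    ((ae_norm_kernelField_sub_le hN hB hτ).mono fun t ht => continuous_of_norm_sub_le ht)
    (fun x => ?_) hγ.aestronglyMeasurable_timeMeasure
  exact (ContinuousLinearMap.compL ℝ (Euc k) (Euc d) (Euc d)).aestronglyMeasurable_comp₂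
    (hN.aestronglyMeasurable_fderiv_flow hτ x) (hB.aestronglyMeasurable x)

end Kernel

section Trajectory

variable {N : ℝ → Euc d → Euc d} {B : ℝ → Euc d → (Euc k →L[ℝ] Euc d)} {t₀ T Λ₁ Λ₂ LB τ : ℝ}

theorem isCaratheodory_controlled (hN : DriftAssumption N t₀ T Λ₁ Λ₂)
    (hB : InputAssumption B t₀ T LB) (u : Control k t₀ T) :
    IsCaratheodory (fun t x => N t x + B t x (u t)) t₀ T (Λ₁ + LB * ‖u‖) where
  nonneg := add_nonneg hN.lipschitz_pos.le (mul_nonneg hB.bound_nonneg (norm_nonneg _))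
  lipschitz := by
    filter_upwards [u.ae_norm_le, ae_restrict_mem measurableSet_Ioc] with t ht htI x y
    have htI' := Ioc_subset_Icc_self htI
    have hLB := hB.bound_nonneg
    rw [add_sub_add_comm, ← _root_.sub_apply]
    calc _ ≤ Λ₁ * ‖x - y‖ + LB * ‖x - y‖ * ‖u‖ := by
          refine (norm_add_le _ _).trans (add_le_add (hN.norm_sub_le htI' x y) ?_)
          refine (ContinuousLinearMap.le_opNorm _ _).trans ?_
          exact mul_le_mul (hB.norm_sub_le htI' x y) ht (norm_nonneg _) (by positivity)
      _ = _ := by ring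
  integrable x := by
    refine (hN.isCaratheodory.integrable x).add (Integrable.of_bound
      (C := inputNorm B t₀ T * ‖u‖)
      ((ContinuousLinearMap.id ℝ (Euc k →L[ℝ] Euc d)).aestronglyMeasurable_comp₂
        (hB.aestronglyMeasurable x) (Lp.aestronglyMeasurable u)) ?_)
    filter_upwards [u.ae_norm_le, hB.ae_norm_le] with t ht1 ht2
    exact (ContinuousLinearMap.le_opNorm _ _).trans
      (mul_le_mul (ht2 x) ht1 (norm_nonneg _) (inputNorm_nonneg B t₀ T))

theorem isSolution_trajectory (hN : DriftAssumption N t₀ T Λ₁ Λ₂)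
    (hB : InputAssumption B t₀ T LB) (hT : t₀ < T) (x₀ : Euc d) (u : Control k t₀ T) :
    IsSolution (fun t x => N t x + B t x (u t)) t₀ T t₀ x₀ (trajectory N B t₀ T x₀ u) :=
  (isCaratheodory_controlled hN hB u).isSolution_solution (left_mem_Icc.2 hT.le) x₀

/-- Trajectories depend in a Lipschitz way on the control. -/
theorem norm_trajectory_sub_le (hN : DriftAssumption N t₀ T Λ₁ Λ₂)
    (hB : InputAssumption B t₀ T LB) (hT : t₀ < T) (x₀ : Euc d) {u v : Control k t₀ T} {R : ℝ}
    (hu : ‖u‖ ≤ R) {t : ℝ} (ht : t ∈ Icc t₀ T) :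
    ‖trajectory N B t₀ T x₀ u t - trajectory N B t₀ T x₀ v t‖ ≤
      inputNorm B t₀ T * (T - t₀) * Real.exp ((Λ₁ + LB * R) * (T - t₀)) * ‖u - v‖ := by
  have hM := inputNorm_nonneg B t₀ T
  have hLB := hB.bound_nonneg
  have hΛ₁ := hN.lipschitz_pos
  have hΔ : 0 < T - t₀ := sub_pos.2 hT
  have hR : 0 ≤ R := (norm_nonneg _).trans hu
  have hcu := isCaratheodory_controlled hN hB u
  -- The Lipschitz constant is that of the equation driven by u, and the defect B(u - v) is
  -- evaluated along the trajectory of v. Hence only u has to be bounded by R.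
  have h := IsSolution.norm_sub_le hcu.nonneg hcu.lipschitz (left_mem_Icc.2 hT.le)
    (isSolution_trajectory hN hB hT x₀ u) (isSolution_trajectory hN hB hT x₀ v)
    (ε := inputNorm B t₀ T * ‖u - v‖) (by positivity) (by
      filter_upwards [(u - v).ae_norm_le, hB.ae_norm_le, Lp.coeFn_sub u v] with t ht1 ht2 ht3
      rw [add_sub_add_left_eq_sub, ← map_sub]
      rw [ht3, Pi.sub_apply] at ht1
      exact (ContinuousLinearMap.le_opNorm _ _).trans
        (mul_le_mul (ht2 _) ht1 (norm_nonneg _) hM)) t ht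
  rw [sub_self, norm_zero, zero_add, abs_of_nonneg (sub_nonneg.2 ht.1)] at h
  refine h.trans ?_
  calc _ ≤ inputNorm B t₀ T * ‖u - v‖ * (T - t₀) * Real.exp ((Λ₁ + LB * R) * (T - t₀)) := by
        gcongr
        · exact sub_nonneg.2 ht.1
        · exact ht.2
    _ = _ := by ring

theorem ae_norm_inputKernel_le (hN : DriftAssumption N t₀ T Λ₁ Λ₂)
    (hB : InputAssumption B t₀ T LB) (hτ : τ ∈ Icc t₀ T) (x₀ : Euc d) (u : Control k t₀ T) :
    ∀ᵐ t ∂timeMeasure t₀ T, ‖inputKernel N B t₀ T τ x₀ u t‖ ≤ kernelBound B t₀ T Λ₁ :=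
  (ae_norm_kernelField_le hN hB hτ).mono fun _ ht => ht _

theorem aestronglyMeasurable_inputKernel (hN : DriftAssumption N t₀ T Λ₁ Λ₂)
    (hB : InputAssumption B t₀ T LB) (hT : t₀ < T) (hτ : τ ∈ Icc t₀ T) (x₀ : Euc d)
    (u : Control k t₀ T) :
    AEStronglyMeasurable (inputKernel N B t₀ T τ x₀ u) (timeMeasure t₀ T) :=
  aestronglyMeasurable_kernelField hN hB hτ (isSolution_trajectory hN hB hT x₀ u).continuousOn

theorem memLp_adjoint_kernel_apply {K : ℝ → Euc k →L[ℝ] Euc d} {c : ℝ}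
    (hK : AEStronglyMeasurable K (timeMeasure t₀ T)) (hc : ∀ᵐ t ∂timeMeasure t₀ T, ‖K t‖ ≤ c)
    (p : Euc d) :
    MemLp (fun t => ContinuousLinearMap.adjoint (K t) p) ∞ (timeMeasure t₀ T) := by
  refine memLp_top_of_bound ?_ (c * ‖p‖) ?_
  · exact ((ContinuousLinearMap.apply ℝ (Euc k) p).continuous.comp
      (ContinuousLinearMap.adjoint (𝕜 := ℝ) (E := Euc k) (F := Euc d)).continuous
      ).comp_aestronglyMeasurable hK
  · filter_upwards [hc] with t ht
    exact ContinuousLinearMap.le_of_opNorm_le _ (by rwa [norm_adjoint]) _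

theorem memLp_minControl (hN : DriftAssumption N t₀ T Λ₁ Λ₂)
    (hB : InputAssumption B t₀ T LB) (hT : t₀ < T) (hτ : τ ∈ Icc t₀ T) (x₀ y : Euc d)
    (u : Control k t₀ T) :
    MemLp (minControl N B t₀ T τ x₀ y u) ∞ (timeMeasure t₀ T) :=
  memLp_adjoint_kernel_apply (aestronglyMeasurable_inputKernel hN hB hT hτ x₀ u)
    (ae_norm_inputKernel_le hN hB hτ x₀ u) _

/-- The default value 0 in `synthesis` is never taken. -/
theorem synthesis_ae_eq (hN : DriftAssumption N t₀ T Λ₁ Λ₂)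
    (hB : InputAssumption B t₀ T LB) (hT : t₀ < T) (hτ : τ ∈ Icc t₀ T) (x₀ y : Euc d)
    (u : Control k t₀ T) :
    synthesis N B t₀ T τ x₀ y u =ᵐ[timeMeasure t₀ T] minControl N B t₀ T τ x₀ y u := by
  rw [synthesis, dif_pos (memLp_minControl hN hB hT hτ x₀ y u)]
  exact MemLp.coeFn_toLp _

theorem integrable_comp_adjoint {K : ℝ → Euc k →L[ℝ] Euc d} {c : ℝ}
    (hK : AEStronglyMeasurable K (timeMeasure t₀ T)) (hc : ∀ᵐ t ∂timeMeasure t₀ T, ‖K t‖ ≤ c) :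
    Integrable (fun t => (K t).comp (ContinuousLinearMap.adjoint (K t))) (timeMeasure t₀ T) := by
  refine Integrable.of_bound (C := c * c) ?_ ?_
  · exact (ContinuousLinearMap.compL ℝ (Euc d) (Euc k) (Euc d)).aestronglyMeasurable_comp₂ hK
      ((ContinuousLinearMap.adjoint (𝕜 := ℝ) (E := Euc k) (F := Euc d)
        ).continuous.comp_aestronglyMeasurable hK)
  · filter_upwards [hc] with t ht
    refine (ContinuousLinearMap.opNorm_comp_le _ _).trans ?_
    rw [norm_adjoint]
    gcongr
    exact (norm_nonneg _).trans ht

theorem norm_comp_adjoint_sub_le {A A' : Euc k →L[ℝ] Euc d} {c : ℝ} (hA : ‖A‖ ≤ c)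
    (hA' : ‖A'‖ ≤ c) :
    ‖A.comp (ContinuousLinearMap.adjoint A) - A'.comp (ContinuousLinearMap.adjoint A')‖ ≤
      2 * c * ‖A - A'‖ := by
  have h : A.comp (ContinuousLinearMap.adjoint A) - A'.comp (ContinuousLinearMap.adjoint A') =
      (A - A').comp (ContinuousLinearMap.adjoint A) +
        A'.comp (ContinuousLinearMap.adjoint A - ContinuousLinearMap.adjoint A') := by
    ext v; simp
  rw [h]
  calc _ ≤ ‖A - A'‖ * c + c * ‖A - A'‖ := by
        refine (norm_add_le _ _).trans (add_le_add ?_ ?_)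
        · refine (ContinuousLinearMap.opNorm_comp_le _ _).trans ?_
          rw [norm_adjoint]; gcongr
        · refine (ContinuousLinearMap.opNorm_comp_le _ _).trans ?_
          rw [norm_adjoint_sub]; gcongr
    _ = _ := by ring

theorem intervalIntegrable_gramian (hN : DriftAssumption N t₀ T Λ₁ Λ₂)
    (hB : InputAssumption B t₀ T LB) (hT : t₀ < T) (hτ : τ ∈ Icc t₀ T) (x₀ : Euc d)
    (u : Control k t₀ T) :
    IntervalIntegrable (fun t => (inputKernel N B t₀ T τ x₀ u t).comp
      (ContinuousLinearMap.adjoint (inputKernel N B t₀ T τ x₀ u t))) volume t₀ T := by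
  rw [intervalIntegrable_iff, uIoc_of_le hT.le]
  exact integrable_comp_adjoint (aestronglyMeasurable_inputKernel hN hB hT hτ x₀ u)
    (ae_norm_inputKernel_le hN hB hτ x₀ u)

/-- The Gramian is Lipschitz on bounded sets of controls. -/
theorem exists_lipschitzOnWith_gramian (hN : DriftAssumption N t₀ T Λ₁ Λ₂)
    (hB : InputAssumption B t₀ T LB) (hT : t₀ < T) (hτ : τ ∈ Icc t₀ T) (x₀ : Euc d) (R : ℝ) :
    ∃ L : ℝ≥0, 0 < L ∧ LipschitzOnWith L (gramian N B t₀ T τ x₀) {u | ‖u‖ ≤ R} := by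
  have hκ : 0 ≤ kernelBound B t₀ T Λ₁ := kernelBound_nonneg
  have hLk := kernelLip_nonneg hN hB hT
  have hΔ : 0 < T - t₀ := sub_pos.2 hT
  set c := inputNorm B t₀ T * (T - t₀) * Real.exp ((Λ₁ + LB * R) * (T - t₀)) with hc
  have hc0 : 0 ≤ c := by have := inputNorm_nonneg B t₀ T; positivity
  set L := 2 * kernelBound B t₀ T Λ₁ * (kernelLip B t₀ T Λ₁ Λ₂ LB * c) * (T - t₀) with hL
  have hL0 : 0 ≤ L := by positivity
  -- The added 1 makes the constant strictly positive even if L vanishes.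
  refine ⟨Real.toNNReal (L + 1), Real.toNNReal_pos.2 (by positivity),
    LipschitzOnWith.of_dist_le_mul fun u hu v hv => ?_⟩
  rw [dist_eq_norm, dist_eq_norm, gramian, gramian, ← intervalIntegral.integral_sub
    (intervalIntegrable_gramian hN hB hT hτ x₀ u) (intervalIntegrable_gramian hN hB hT hτ x₀ v)]
  have hae : ∀ᵐ t ∂timeMeasure t₀ T, ‖(inputKernel N B t₀ T τ x₀ u t).comp
        (ContinuousLinearMap.adjoint (inputKernel N B t₀ T τ x₀ u t)) -
      (inputKernel N B t₀ T τ x₀ v t).comp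
        (ContinuousLinearMap.adjoint (inputKernel N B t₀ T τ x₀ v t))‖ ≤
      2 * kernelBound B t₀ T Λ₁ * (kernelLip B t₀ T Λ₁ Λ₂ LB * (c * ‖u - v‖)) := by
    filter_upwards [ae_norm_inputKernel_le hN hB hτ x₀ u, ae_norm_inputKernel_le hN hB hτ x₀ v,
      ae_norm_kernelField_sub_le hN hB hτ, ae_restrict_mem measurableSet_Ioc] with t h1 h2 h3 h4
    refine (norm_comp_adjoint_sub_le h1 h2).trans ?_
    gcongr
    refine (h3 _ _).trans ?_
    gcongr
    exact norm_trajectory_sub_le hN hB hT x₀ hu (Ioc_subset_Icc_self h4)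
  have h := intervalIntegral.norm_integral_le_of_norm_le_const_ae (a := t₀) (b := T)
    (by rw [uIoc_of_le hT.le, ← ae_restrict_iff' measurableSet_Ioc]; exact hae)
  rw [abs_of_pos hΔ] at h
  refine h.trans ?_
  rw [Real.coe_toNNReal _ (by positivity)]
  calc _ = L * ‖u - v‖ := by rw [hL]; ring
    _ ≤ _ := by gcongr; linarith

theorem inner_gramian_apply (hN : DriftAssumption N t₀ T Λ₁ Λ₂)
    (hB : InputAssumption B t₀ T LB) (hT : t₀ < T) (hτ : τ ∈ Icc t₀ T) (x₀ : Euc d)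
    (u : Control k t₀ T) (v w : Euc d) :
    inner ℝ w (gramian N B t₀ T τ x₀ u v) =
      ∫ t in t₀..T, inner ℝ (ContinuousLinearMap.adjoint (inputKernel N B t₀ T τ x₀ u t) w)
        (ContinuousLinearMap.adjoint (inputKernel N B t₀ T τ x₀ u t) v) := by
  have h := ((innerSL ℝ w).comp (ContinuousLinearMap.apply ℝ (Euc d) v)).intervalIntegral_comp_comm
    (intervalIntegrable_gramian hN hB hT hτ x₀ u)
  rw [gramian]
  refine h.symm.trans (intervalIntegral.integral_congr fun t _ => ?_)
  simp [ContinuousLinearMap.adjoint_inner_left]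

end Trajectory

end Control

/-! ### Smallest eigenvalue and pseudoinverse of symmetric and coercive operators. -/

section SymmetricOperator

variable {d : ℕ}

/-- The smallest eigenvalue of a symmetric operator is an eigenvalue, and the infimum of the
Rayleigh quotient. -/
theorem hasEigenvalue_lambdaMin (hd : 0 < d) {A : Euc d →L[ℝ] Euc d}
    (hA : (A : Euc d →ₗ[ℝ] Euc d).IsSymmetric) :
    Module.End.HasEigenvalue (A : Euc d →ₗ[ℝ] Euc d) (lambdaMin A) ∧
      ∀ x, lambdaMin A * ‖x‖ ^ 2 ≤ inner ℝ (A x) x := by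
  have : Nonempty (Fin d) := ⟨⟨0, hd⟩⟩
  set m : ℝ := ⨅ x : {x : Euc d // x ≠ 0}, inner ℝ (A x) (x : Euc d) / ‖(x : Euc d)‖ ^ 2 with hm
  have heig : Module.End.HasEigenvalue (A : Euc d →ₗ[ℝ] Euc d) m := by
    simpa using hA.hasEigenvalue_iInf_of_finiteDimensional
  have hbdd : BddBelow (range fun x : {x : Euc d // x ≠ 0} =>
      inner ℝ (A x) (x : Euc d) / ‖(x : Euc d)‖ ^ 2) := by
    refine ⟨-‖A‖, ?_⟩
    rintro _ ⟨x, rfl⟩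
    have hx : 0 < ‖(x : Euc d)‖ ^ 2 := by have := norm_pos_iff.2 x.2; positivity
    simp only
    rw [le_div_iff₀ hx]
    have h1 := abs_le.1 (abs_real_inner_le_norm (A x) (x : Euc d))
    have h2 := A.le_opNorm x
    nlinarith [norm_nonneg (x : Euc d)]
  have hle : ∀ x : Euc d, m * ‖x‖ ^ 2 ≤ inner ℝ (A x) x := fun x => by
    rcases eq_or_ne x 0 with rfl | hx
    · simp
    · have h0 : 0 < ‖x‖ ^ 2 := by have := norm_pos_iff.2 hx; positivity
      exact (le_div_iff₀ h0).1 (ciInf_le hbdd ⟨x, hx⟩)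
  have hmin : lambdaMin A = m := by
    refine IsLeast.csInf_eq ⟨heig, fun μ hμ => ?_⟩
    obtain ⟨v, hv⟩ := Module.End.HasEigenvalue.exists_hasEigenvector hμ
    have h1 := hle v
    have h2 : A v = μ • v := hv.apply_eq_smul
    rw [h2, inner_smul_left, real_inner_self_eq_norm_sq] at h1
    have h0 : 0 < ‖v‖ ^ 2 := by have := norm_pos_iff.2 hv.2; positivity
    exact le_of_mul_le_mul_right h1 h0
  rw [hmin]
  exact ⟨heig, hle⟩

theorem le_lambdaMin (hd : 0 < d) {A : Euc d →L[ℝ] Euc d}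
    (hA : (A : Euc d →ₗ[ℝ] Euc d).IsSymmetric) {c : ℝ} (h : ∀ x, c * ‖x‖ ^ 2 ≤ inner ℝ (A x) x) :
    c ≤ lambdaMin A := by
  obtain ⟨v, hv⟩ := (hasEigenvalue_lambdaMin hd hA).1.exists_hasEigenvector
  have h1 := h v
  have h2 : A v = lambdaMin A • v := hv.apply_eq_smul
  rw [h2, inner_smul_left, real_inner_self_eq_norm_sq] at h1
  have h0 : 0 < ‖v‖ ^ 2 := by have := norm_pos_iff.2 hv.2; positivity
  exact le_of_mul_le_mul_right h1 h0

/-- Weyl's perturbation bound, read off from the Rayleigh quotient. -/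
theorem lambdaMin_sub_norm_sub_le (hd : 0 < d) {A A' : Euc d →L[ℝ] Euc d}
    (hA : (A : Euc d →ₗ[ℝ] Euc d).IsSymmetric) (hA' : (A' : Euc d →ₗ[ℝ] Euc d).IsSymmetric) :
    lambdaMin A - ‖A' - A‖ ≤ lambdaMin A' := by
  refine le_lambdaMin hd hA' fun x => ?_
  have h1 := (hasEigenvalue_lambdaMin hd hA).2 x
  have h2 : inner ℝ (A' x) x = inner ℝ (A x) x + inner ℝ ((A' - A) x) x := by
    rw [← inner_add_left]; simp
  have h3 := abs_le.1 (abs_real_inner_le_norm ((A' - A) x) x)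
  have h4 := (A' - A).le_opNorm x
  nlinarith [norm_nonneg x]

/-- The pseudoinverse of an invertible operator is its inverse. -/
theorem pinv_mul_and_mul_pinv {A : Euc d →L[ℝ] Euc d} (hA : IsUnit A) :
    pinv A * A = 1 ∧ A * pinv A = 1 := by
  obtain ⟨a, rfl⟩ := hA
  have hex : ∃ X, IsMoorePenrose (a : Euc d →L[ℝ] Euc d) X :=
    ⟨↑a⁻¹, by simp, by simp, by simp, by simp⟩
  have h : IsMoorePenrose (a : Euc d →L[ℝ] Euc d) (pinv a) := by
    rw [pinv, dif_pos hex]; exact hex.choose_spec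
  have h1 : (a : Euc d →L[ℝ] Euc d) * pinv a = 1 := by
    have := h.mul_mul_self
    exact a.isUnit.mul_right_cancel (by rw [this, one_mul])
  refine ⟨?_, h1⟩
  have := h.mul_mul_self
  rw [mul_assoc] at this
  exact a.isUnit.mul_left_cancel (by rw [this, mul_one])

/-- A coercive operator is invertible and its pseudoinverse is bounded. -/
theorem apply_pinv_of_coercive {A : Euc d →L[ℝ] Euc d} {c : ℝ} (hc : 0 < c)
    (h : ∀ x, c⁻¹ * ‖x‖ ^ 2 ≤ inner ℝ (A x) x) :
    (∀ y, A (pinv A y) = y) ∧ (∀ y, pinv A (A y) = y) ∧ ∀ y, ‖pinv A y‖ ≤ c * ‖y‖ := by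
  have hinj : Function.Injective A := by
    refine (injective_iff_map_eq_zero A).2 fun x hx => ?_
    have h1 := h x
    rw [hx, inner_zero_left] at h1
    have h2 : 0 < c⁻¹ := inv_pos.2 hc
    have h3 : ‖x‖ ^ 2 ≤ 0 := by
      by_contra hcon
      push Not at hcon
      nlinarith
    exact norm_eq_zero.1 (pow_eq_zero_iff two_ne_zero |>.1 (le_antisymm h3 (sq_nonneg _)))
  have hunit : IsUnit A := by
    let e := (LinearEquiv.ofInjectiveEndo (A : Euc d →ₗ[ℝ] Euc d) hinj).toContinuousLinearEquiv
    have he : (e : Euc d →L[ℝ] Euc d) = A := by ext x; rfl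
    rw [← he]
    exact ⟨ContinuousLinearEquiv.toUnit e, rfl⟩
  obtain ⟨h1, h2⟩ := pinv_mul_and_mul_pinv hunit
  have h2' : ∀ y, A (pinv A y) = y := fun y => congrArg (fun L : Euc d →L[ℝ] Euc d => L y) h2
  refine ⟨h2', fun y => congrArg (fun L : Euc d →L[ℝ] Euc d => L y) h1, fun y => ?_⟩
  have h3 := h (pinv A y)
  rw [h2'] at h3
  have h4 := real_inner_le_norm y (pinv A y)
  rcases (norm_nonneg (pinv A y)).eq_or_lt with h0 | h0
  · rw [← h0]; positivity
  · rw [inv_mul_le_iff₀ hc] at h3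
    have h5 : ‖pinv A y‖ * ‖pinv A y‖ ≤ c * ‖y‖ * ‖pinv A y‖ := by nlinarith
    exact le_of_mul_le_mul_right h5 h0

/-- The resolvent identity A⁻¹ - A'⁻¹ = -A⁻¹(A - A')A'⁻¹, with each inverse bounded by c.
Pseudoinversion is thereby continuous on a uniformly coercive class. -/
theorem norm_pinv_apply_sub_le {A A' : Euc d →L[ℝ] Euc d} {c : ℝ} (hc : 0 < c)
    (h : ∀ x, c⁻¹ * ‖x‖ ^ 2 ≤ inner ℝ (A x) x) (h' : ∀ x, c⁻¹ * ‖x‖ ^ 2 ≤ inner ℝ (A' x) x)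
    (y : Euc d) : ‖pinv A y - pinv A' y‖ ≤ c * (‖A - A'‖ * (c * ‖y‖)) := by
  obtain ⟨h1, h2, h3⟩ := apply_pinv_of_coercive hc h
  obtain ⟨h1', h2', h3'⟩ := apply_pinv_of_coercive hc h'
  have heq : pinv A y - pinv A' y = -pinv A ((A - A') (pinv A' y)) := by
    rw [_root_.sub_apply, map_sub, h1', h2]; abel
  rw [heq, norm_neg]
  refine (h3 _).trans ?_
  gcongr
  exact ((A - A').le_opNorm _).trans (by gcongr; exact h3' y)

end SymmetricOperator

/-! ### Positivity of the zero-control Gramian, feedback controls and coercivity on the norm ball.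
-/

section FixedPoint

variable {d k : ℕ} {N : ℝ → Euc d → Euc d} {B : ℝ → Euc d → (Euc k →L[ℝ] Euc d)}
  {t₀ T Λ₁ Λ₂ LB τ : ℝ}

/-- Controls are classes modulo null sets, so two fields can be compared only for almost every time,
and agreement along γ is enough. -/
theorem IsSolution.congr_ae {f g : ℝ → Euc d → Euc d} {s : ℝ} {x : Euc d} {γ : ℝ → Euc d}
    (h : IsSolution f t₀ T s x γ) (hs : s ∈ Icc t₀ T)
    (hfg : ∀ᵐ r ∂timeMeasure t₀ T, f r (γ r) = g r (γ r)) : IsSolution g t₀ T s x γ where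
  continuousOn := h.continuousOn
  intervalIntegrable := by
    have hle : t₀ ≤ T := hs.1.trans hs.2
    have h1 := h.intervalIntegrable
    rw [intervalIntegrable_iff, uIoc_of_le hle] at h1 ⊢
    exact Integrable.congr h1 hfg
  integral_eq t ht := by
    rw [h.integral_eq t ht]
    congr 1
    refine intervalIntegral.integral_congr_ae ?_
    rw [← ae_restrict_iff' measurableSet_uIoc]
    exact ae_restrict_uIoc_of_timeMeasure hfg hs ht

theorem isSymmetric_gramian (hN : DriftAssumption N t₀ T Λ₁ Λ₂)
    (hB : InputAssumption B t₀ T LB) (hT : t₀ < T) (hτ : τ ∈ Icc t₀ T) (x₀ : Euc d)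
    (u : Control k t₀ T) :
    (gramian N B t₀ T τ x₀ u : Euc d →ₗ[ℝ] Euc d).IsSymmetric := fun x y => by
  change inner ℝ (gramian N B t₀ T τ x₀ u x) y = inner ℝ x (gramian N B t₀ T τ x₀ u y)
  rw [real_inner_comm, inner_gramian_apply hN hB hT hτ, inner_gramian_apply hN hB hT hτ]
  exact intervalIntegral.integral_congr fun t _ => real_inner_comm _ _

theorem inner_gramian_apply_self (hN : DriftAssumption N t₀ T Λ₁ Λ₂)
    (hB : InputAssumption B t₀ T LB) (hT : t₀ < T) (hτ : τ ∈ Icc t₀ T) (x₀ : Euc d)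
    (u : Control k t₀ T) (v : Euc d) :
    inner ℝ (gramian N B t₀ T τ x₀ u v) v =
      ∫ t in t₀..T, ‖ContinuousLinearMap.adjoint (inputKernel N B t₀ T τ x₀ u t) v‖ ^ 2 := by
  rw [real_inner_comm, inner_gramian_apply hN hB hT hτ]
  exact intervalIntegral.integral_congr fun t _ => real_inner_self_eq_norm_sq _

theorem inner_gramian_apply_self_nonneg (hN : DriftAssumption N t₀ T Λ₁ Λ₂)
    (hB : InputAssumption B t₀ T LB) (hT : t₀ < T) (hτ : τ ∈ Icc t₀ T) (x₀ : Euc d)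
    (u : Control k t₀ T) (v : Euc d) :
    0 ≤ inner ℝ (gramian N B t₀ T τ x₀ u v) v := by
  rw [inner_gramian_apply_self hN hB hT hτ]
  exact intervalIntegral.integral_nonneg hT.le fun _ _ => sq_nonneg _

/-- Without control, changing the reference time composes the kernel with a fixed isomorphism. -/
theorem inputKernel_zero_eq_comp (hN : DriftAssumption N t₀ T Λ₁ Λ₂)
    (hB : InputAssumption B t₀ T LB) (hT : t₀ < T) (hτ : τ ∈ Icc t₀ T) (x₀ : Euc d) {t : ℝ}
    (ht : t ∈ Icc t₀ T) :
    inputKernel N B t₀ T τ x₀ 0 t =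
      (fderiv ℝ (flow N t₀ T T τ) (trajectory N B t₀ T x₀ 0 T)).comp
        (inputKernel N B t₀ T T x₀ 0 t) := by
  have hT' := right_mem_Icc.2 hT.le
  have h0 := left_mem_Icc.2 hT.le
  have hsol : IsSolution N t₀ T t₀ x₀ (trajectory N B t₀ T x₀ 0) := by
    refine (isSolution_trajectory hN hB hT x₀ 0).congr_ae h0 ?_
    filter_upwards [Lp.coeFn_zero (Euc k) ∞ (timeMeasure t₀ T)] with r hr
    rw [hr]; simp
  rw [inputKernel, inputKernel, hN.fderiv_flow_comp ht hT' hτ,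
    hN.flow_apply_solution h0 ht hT' hsol, ContinuousLinearMap.comp_assoc]

/-- If the Gramian at the final reference time is invertible, the Gramian at any reference time is
positive definite. -/
theorem lambdaMin_zeroGramian_pos (hd : 0 < d) (hN : DriftAssumption N t₀ T Λ₁ Λ₂)
    (hB : InputAssumption B t₀ T LB) (hT : t₀ < T) (hτ : τ ∈ Icc t₀ T) (x₀ : Euc d)
    (hW : IsUnit (zeroGramian N B t₀ T T x₀)) : 0 < lambdaMin (zeroGramian N B t₀ T τ x₀) := by
  have hT' := right_mem_Icc.2 hT.le
  unfold zeroGramian at hW ⊢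
  have hfin : 0 < lambdaMin (gramian N B t₀ T T x₀ 0) := by
    have hsymm := isSymmetric_gramian hN hB hT hT' x₀ 0
    refine lt_of_le_of_ne (le_lambdaMin hd hsymm fun v => ?_) fun h0 => ?_
    · rw [zero_mul]; exact inner_gramian_apply_self_nonneg hN hB hT hT' x₀ 0 v
    · obtain ⟨v, hv⟩ := (hasEigenvalue_lambdaMin hd hsymm).1.exists_hasEigenvector
      have h1 : gramian N B t₀ T T x₀ 0 v = 0 := by
        have h2 : gramian N B t₀ T T x₀ 0 v = lambdaMin (gramian N B t₀ T T x₀ 0) • v :=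
          hv.apply_eq_smul
        rw [h2, ← h0, zero_smul]
      refine hv.2 ?_
      have h3 := congrArg (fun L : Euc d →L[ℝ] Euc d => L v) (pinv_mul_and_mul_pinv hW).1
      change pinv _ (gramian N B t₀ T T x₀ 0 v) = v at h3
      rw [← h3, h1, map_zero]
  have hsymm := isSymmetric_gramian hN hB hT hτ x₀ 0
  obtain ⟨v, hv⟩ := (hasEigenvalue_lambdaMin hd hsymm).1.exists_hasEigenvector
  have h1 : gramian N B t₀ T τ x₀ 0 v = lambdaMin (gramian N B t₀ T τ x₀ 0) • v :=
    hv.apply_eq_smul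
  set D := fderiv ℝ (flow N t₀ T T τ) (trajectory N B t₀ T x₀ 0 T) with hD
  -- Congruence of the Gramians, 𝒩_τ(0) = D 𝒩_T(0) Dᵀ, as quadratic forms. Since D is invertible, Dᵀ
  -- v ≠ 0 for the eigenvector v.
  have h2 : inner ℝ (gramian N B t₀ T τ x₀ 0 v) v =
      inner ℝ (gramian N B t₀ T T x₀ 0 (ContinuousLinearMap.adjoint D v))
        (ContinuousLinearMap.adjoint D v) := by
    rw [inner_gramian_apply_self hN hB hT hτ, inner_gramian_apply_self hN hB hT hT']
    refine intervalIntegral.integral_congr fun t ht => ?_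
    rw [uIcc_of_le hT.le] at ht
    simp only [inputKernel_zero_eq_comp hN hB hT hτ x₀ ht, ContinuousLinearMap.adjoint_comp,
      ContinuousLinearMap.comp_apply]
    rfl
  have h3 : ContinuousLinearMap.adjoint D v ≠ 0 := fun h0 => by
    obtain ⟨a, ha⟩ := hN.isUnit_fderiv_flow hT' hτ (trajectory N B t₀ T x₀ 0 T)
    refine hv.2 ?_
    have h4 : ∀ w, inner ℝ v (D w) = 0 := fun w => by
      rw [← ContinuousLinearMap.adjoint_inner_left, h0, inner_zero_left]
    have h5 : D ((↑a⁻¹ : Euc d →L[ℝ] Euc d) v) = v := by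
      rw [hD, ← ha]
      exact congrArg (fun L : Euc d →L[ℝ] Euc d => L v) a.mul_inv
    have h6 := h4 ((↑a⁻¹ : Euc d →L[ℝ] Euc d) v)
    rw [h5] at h6
    exact inner_self_eq_zero.1 h6
  have h4 := (hasEigenvalue_lambdaMin hd (isSymmetric_gramian hN hB hT hT' x₀ 0)).2
    (ContinuousLinearMap.adjoint D v)
  rw [← h2, h1, inner_smul_left, real_inner_self_eq_norm_sq] at h4
  have h5 : 0 < ‖ContinuousLinearMap.adjoint D v‖ ^ 2 := by
    have := norm_pos_iff.2 h3; positivity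
  have h6 : 0 < lambdaMin (gramian N B t₀ T τ x₀ 0) * ‖v‖ ^ 2 :=
    lt_of_lt_of_le (mul_pos hfin h5) h4
  exact pos_of_mul_pos_left h6 (sq_nonneg _)

/-- The closed loop obtained by feeding back `u = K(t, x)ᵀ p`, where `K` is the kernel. -/
noncomputable def closedLoopField (N : ℝ → Euc d → Euc d) (B : ℝ → Euc d → (Euc k →L[ℝ] Euc d))
    (t₀ T τ : ℝ) (p : Euc d) (t : ℝ) (x : Euc d) : Euc d :=
  N t x + B t x (ContinuousLinearMap.adjoint (kernelField N B t₀ T τ t x) p)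

theorem isCaratheodory_closedLoopField (hN : DriftAssumption N t₀ T Λ₁ Λ₂)
    (hB : InputAssumption B t₀ T LB) (hT : t₀ < T) (hτ : τ ∈ Icc t₀ T) (p : Euc d) :
    IsCaratheodory (closedLoopField N B t₀ T τ p) t₀ T
      (Λ₁ + (LB * kernelBound B t₀ T Λ₁ +
        inputNorm B t₀ T * kernelLip B t₀ T Λ₁ Λ₂ LB) * ‖p‖) := by
  have hLB := hB.bound_nonneg
  have hM := inputNorm_nonneg B t₀ T
  have hκ : 0 ≤ kernelBound B t₀ T Λ₁ := kernelBound_nonneg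
  have hLk := kernelLip_nonneg hN hB hT
  have hΛ₁ := hN.lipschitz_pos
  refine ⟨by positivity, ?_, fun x => ?_⟩
  · filter_upwards [hB.ae_norm_le, ae_norm_kernelField_le hN hB hτ,
      ae_norm_kernelField_sub_le hN hB hτ, ae_restrict_mem measurableSet_Ioc] with t h1 h2 h3 h4 x y
    have h4' := Ioc_subset_Icc_self h4
    set Kx := ContinuousLinearMap.adjoint (kernelField N B t₀ T τ t x)
    set Ky := ContinuousLinearMap.adjoint (kernelField N B t₀ T τ t y)
    have h5 : closedLoopField N B t₀ T τ p t x - closedLoopField N B t₀ T τ p t y =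
        (N t x - N t y) + ((B t x - B t y) (Kx p) + B t y ((Kx - Ky) p)) := by
      simp [closedLoopField, Kx, Ky]; abel
    rw [h5]
    have h6 : ‖Kx p‖ ≤ kernelBound B t₀ T Λ₁ * ‖p‖ :=
      ContinuousLinearMap.le_of_opNorm_le _ (by rw [norm_adjoint]; exact h2 x) p
    have h7 : ‖(Kx - Ky) p‖ ≤ kernelLip B t₀ T Λ₁ Λ₂ LB * ‖x - y‖ * ‖p‖ :=
      ContinuousLinearMap.le_of_opNorm_le _ (by rw [norm_adjoint_sub]; exact h3 x y) p
    calc _ ≤ Λ₁ * ‖x - y‖ + (LB * ‖x - y‖ * (kernelBound B t₀ T Λ₁ * ‖p‖) +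
          inputNorm B t₀ T * (kernelLip B t₀ T Λ₁ Λ₂ LB * ‖x - y‖ * ‖p‖)) := by
          refine (norm_add_le _ _).trans (add_le_add (hN.norm_sub_le h4' x y)
            ((norm_add_le _ _).trans (add_le_add ?_ ?_)))
          · exact (ContinuousLinearMap.le_opNorm _ _).trans
              (mul_le_mul (hB.norm_sub_le h4' x y) h6 (norm_nonneg _) (by positivity))
          · exact (ContinuousLinearMap.le_opNorm _ _).trans
              (mul_le_mul (h1 y) h7 (norm_nonneg _) hM)
      _ = _ := by ring
  · have hmem := memLp_adjoint_kernel_apply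
      (aestronglyMeasurable_kernelField hN hB hτ (continuousOn_const (c := x)))
      ((ae_norm_kernelField_le hN hB hτ).mono fun t ht => ht x) p
    refine (hN.isCaratheodory.integrable x).add (Integrable.of_bound
      (C := inputNorm B t₀ T * (kernelBound B t₀ T Λ₁ * ‖p‖))
      ((ContinuousLinearMap.id ℝ (Euc k →L[ℝ] Euc d)).aestronglyMeasurable_comp₂
        (hB.aestronglyMeasurable x) hmem.aestronglyMeasurable) ?_)
    filter_upwards [hB.ae_norm_le, ae_norm_kernelField_le hN hB hτ] with t h1 h2
    exact (ContinuousLinearMap.le_opNorm _ _).trans (mul_le_mul (h1 x)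
      (ContinuousLinearMap.le_of_opNorm_le _ (by rw [norm_adjoint]; exact h2 x) p)
      (norm_nonneg _) hM)

/-- For every multiplier `p` there is a control satisfying `u = K_uᵀ p`, which is locally Lipschitz
in `p`. -/
theorem exists_feedback_control (hN : DriftAssumption N t₀ T Λ₁ Λ₂)
    (hB : InputAssumption B t₀ T LB) (hT : t₀ < T) (hτ : τ ∈ Icc t₀ T) (x₀ : Euc d) :
    ∃ U : Euc d → Control k t₀ T,
      (∀ p, ∀ᵐ t ∂timeMeasure t₀ T,
        U p t = ContinuousLinearMap.adjoint (inputKernel N B t₀ T τ x₀ (U p) t) p) ∧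
      ∀ R : ℝ, 0 ≤ R → ∃ c : ℝ, 0 ≤ c ∧
        ∀ p q, ‖p‖ ≤ R → ‖q‖ ≤ R → ‖U p - U q‖ ≤ c * ‖p - q‖ := by
  have h0 := left_mem_Icc.2 hT.le
  have hLB := hB.bound_nonneg
  have hM := inputNorm_nonneg B t₀ T
  have hκ : 0 ≤ kernelBound B t₀ T Λ₁ := kernelBound_nonneg
  have hLk := kernelLip_nonneg hN hB hT
  have hΛ₁ := hN.lipschitz_pos
  have hΔ : 0 < T - t₀ := sub_pos.2 hT
  have hcar := fun p => isCaratheodory_closedLoopField hN hB hT hτ p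
  set X : Euc d → ℝ → Euc d := fun p => solution (closedLoopField N B t₀ T τ p) t₀ T t₀ x₀ with hX
  have hsol : ∀ p, IsSolution (closedLoopField N B t₀ T τ p) t₀ T t₀ x₀ (X p) := fun p =>
    (hcar p).isSolution_solution h0 x₀
  have hmem := fun p => memLp_adjoint_kernel_apply
    (aestronglyMeasurable_kernelField hN hB hτ (hsol p).continuousOn)
    ((ae_norm_kernelField_le hN hB hτ).mono fun t ht => ht (X p t)) p
  let U : Euc d → Control k t₀ T := fun p => (hmem p).toLp _
  have hU : ∀ p, ∀ᵐ t ∂timeMeasure t₀ T,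
      U p t = ContinuousLinearMap.adjoint (kernelField N B t₀ T τ t (X p t)) p := fun p =>
    (hmem p).coeFn_toLp
  -- The closed-loop solution also solves the equation driven by its own feedback, and uniqueness
  -- identifies it with the trajectory. This turns state feedback into the implicit relation for
  -- U(p).
  have htraj : ∀ p, EqOn (trajectory N B t₀ T x₀ (U p)) (X p) (Icc t₀ T) := fun p => by
    refine (isSolution_trajectory hN hB hT x₀ (U p)).eqOn (isCaratheodory_controlled hN hB (U p))
      h0 ((hsol p).congr_ae h0 ?_)
    filter_upwards [hU p] with t ht
    rw [ht, closedLoopField]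
  refine ⟨U, fun p => ?_, fun R hR => ?_⟩
  · filter_upwards [hU p, ae_restrict_mem measurableSet_Ioc] with t ht htI
    rw [ht, inputKernel, htraj p (Ioc_subset_Icc_self htI), kernelField]
  · set K := Λ₁ + (LB * kernelBound B t₀ T Λ₁ +
        inputNorm B t₀ T * kernelLip B t₀ T Λ₁ Λ₂ LB) * R with hK
    set c := inputNorm B t₀ T * kernelBound B t₀ T Λ₁ * (T - t₀) * Real.exp (K * (T - t₀)) with hc
    have hc0 : 0 ≤ c := by positivity
    refine ⟨kernelLip B t₀ T Λ₁ Λ₂ LB * c * R + kernelBound B t₀ T Λ₁, by positivity,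
      fun p q hp hq => ?_⟩
    have hXd : ∀ t ∈ Icc t₀ T, ‖X p t - X q t‖ ≤ c * ‖p - q‖ := fun t ht => by
      have h := IsSolution.norm_sub_le (hcar p).nonneg (hcar p).lipschitz h0 (hsol p) (hsol q)
        (ε := inputNorm B t₀ T * (kernelBound B t₀ T Λ₁ * ‖p - q‖)) (by positivity) (by
          filter_upwards [hB.ae_norm_le, ae_norm_kernelField_le hN hB hτ] with r h1 h2
          rw [closedLoopField, closedLoopField, add_sub_add_left_eq_sub, ← map_sub, ← map_sub]
          exact (ContinuousLinearMap.le_opNorm _ _).trans (mul_le_mul (h1 _)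
            (ContinuousLinearMap.le_of_opNorm_le _ (by rw [norm_adjoint]; exact h2 _) _)
            (norm_nonneg _) hM)) t ht
      rw [sub_self, norm_zero, zero_add, abs_of_nonneg (sub_nonneg.2 ht.1)] at h
      refine h.trans ?_
      calc _ ≤ inputNorm B t₀ T * (kernelBound B t₀ T Λ₁ * ‖p - q‖) * (T - t₀) *
            Real.exp (K * (T - t₀)) := by
            gcongr
            · exact sub_nonneg.2 ht.1
            · rw [hK]; gcongr
            · exact ht.2
        _ = _ := by rw [hc]; ring
    refine Control.norm_le_of_ae_norm_le (by positivity) ?_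
    filter_upwards [Lp.coeFn_sub (U p) (U q), hU p, hU q, ae_norm_kernelField_le hN hB hτ,
      ae_norm_kernelField_sub_le hN hB hτ, ae_restrict_mem measurableSet_Ioc]
      with t h1 h2 h3 h4 h5 h6
    rw [h1, Pi.sub_apply, h2, h3]
    set Kp := ContinuousLinearMap.adjoint (kernelField N B t₀ T τ t (X p t)) with hKp
    set Kq := ContinuousLinearMap.adjoint (kernelField N B t₀ T τ t (X q t)) with hKq
    have h7 : Kp p - Kq q = (Kp - Kq) p + Kq (p - q) := by simp
    have h8 : ‖Kp - Kq‖ ≤ kernelLip B t₀ T Λ₁ Λ₂ LB * (c * ‖p - q‖) := by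
      rw [hKp, hKq, norm_adjoint_sub]
      exact (h5 _ _).trans (by gcongr; exact hXd t (Ioc_subset_Icc_self h6))
    have h9 : ‖Kq‖ ≤ kernelBound B t₀ T Λ₁ := by rw [hKq, norm_adjoint]; exact h4 _
    rw [h7]
    calc _ ≤ kernelLip B t₀ T Λ₁ Λ₂ LB * (c * ‖p - q‖) * R + kernelBound B t₀ T Λ₁ * ‖p - q‖ :=
          (norm_add_le _ _).trans (add_le_add
            ((ContinuousLinearMap.le_opNorm _ _).trans
              (mul_le_mul h8 hp (norm_nonneg _) (by positivity)))
            (ContinuousLinearMap.le_of_opNorm_le _ h9 _))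
      _ = _ := by ring

/-- On the feasible ball the Gramians are uniformly coercive, provided that `y` is small. -/
theorem inv_le_lambdaMin_gramian (hd : 0 < d) (hN : DriftAssumption N t₀ T Λ₁ Λ₂)
    (hB : InputAssumption B t₀ T LB) (hT : t₀ < T) (hτ : τ ∈ Icc t₀ T) (x₀ : Euc d)
    {θ lam : ℝ} (hθ : 0 < θ) (hlam : 0 < lam)
    (hlam' : lam = lambdaMin (zeroGramian N B t₀ T τ x₀)) {y : Euc d} {L : ℝ≥0}
    (hL : LipschitzOnWith L (gramian N B t₀ T τ x₀)
      {u | ‖u‖ ≤ controlRadius B t₀ T Λ₁ ((1 + θ) / lam) y})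
    (hy : ‖y‖ ≤ θ * lam ^ 2 /
      ((1 + θ) ^ 2 * L * inputNorm B t₀ T * Real.exp (Λ₁ * (T - t₀))))
    {u : Control k t₀ T} (hu : ‖u‖ ≤ controlRadius B t₀ T Λ₁ ((1 + θ) / lam) y) :
    ((1 + θ) / lam)⁻¹ ≤ lambdaMin (gramian N B t₀ T τ x₀ u) := by
  have h1 := lambdaMin_sub_norm_sub_le hd (isSymmetric_gramian hN hB hT hτ x₀ 0)
    (isSymmetric_gramian hN hB hT hτ x₀ u)
  have h2 := hL.norm_sub_le hu (show (0 : Control k t₀ T) ∈ _ from by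
    rw [mem_ofPred_eq, norm_zero]; exact (norm_nonneg u).trans hu)
  rw [sub_zero] at h2
  have hE := Real.exp_pos (Λ₁ * (T - t₀))
  have hM := inputNorm_nonneg B t₀ T
  set E := Real.exp (Λ₁ * (T - t₀)) with hEdef
  set M := inputNorm B t₀ T with hMdef
  have h3 : L * M * E * ‖y‖ ≤ θ * lam ^ 2 / (1 + θ) ^ 2 := by
    -- If LME = 0, the quotient bounding |y| has denominator 0, but the left-hand side vanishes as
    -- well.
    rcases (show (0 : ℝ) ≤ L * M * E by positivity).eq_or_lt with h0 | h0
    · rw [← h0, zero_mul]; positivity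
    · calc L * M * E * ‖y‖ ≤ L * M * E * (θ * lam ^ 2 / ((1 + θ) ^ 2 * L * M * E)) := by gcongr
        _ = (L * M * E) * (θ * lam ^ 2) / ((L * M * E) * (1 + θ) ^ 2) := by
          rw [← mul_div_assoc]; congr 1; ring
        _ = _ := mul_div_mul_left _ _ h0.ne'
  have h4 : L * ‖u‖ ≤ θ * lam / (1 + θ) := by
    calc L * ‖u‖ ≤ L * ((1 + θ) / lam * M * E * ‖y‖) := by gcongr; exact hu
      _ = (1 + θ) / lam * (L * M * E * ‖y‖) := by ring
      _ ≤ (1 + θ) / lam * (θ * lam ^ 2 / (1 + θ) ^ 2) := by gcongr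
      _ = _ := by field_simp
  rw [zeroGramian] at hlam'
  rw [← hlam'] at h1
  -- The choice of C makes 1/C exactly λ minus the largest perturbation allowed by the bound on |y|.
  have h5 : ((1 + θ) / lam)⁻¹ = lam - θ * lam / (1 + θ) := by field_simp; ring
  rw [h5]
  linarith

end FixedPoint

/-! ### Invariance, existence of a fixed point and the energy bound. -/

theorem corollary3p13 {d k : ℕ} (hd : 0 < d)
    (N : ℝ → Euc d → Euc d) (B : ℝ → Euc d → (Euc k →L[ℝ] Euc d))
    (t₀ T Λ₁ Λ₂ LB : ℝ) (hT : t₀ < T)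
    (hN : DriftAssumption N t₀ T Λ₁ Λ₂) (hB : InputAssumption B t₀ T LB)
    (x₀ : Euc d) (i : Fin 2) (θ : ℝ) (hθ : θ ∈ Set.Ioo (0 : ℝ) 1)
    (hW : IsUnit (zeroGramian N B t₀ T (refTime t₀ T 1) x₀))
    (τ : ℝ) (hτ : τ = refTime t₀ T i)
    (lam : ℝ) (hlam : lam = lambdaMin (zeroGramian N B t₀ T τ x₀))
    (C : ℝ) (hC : C = (1 + θ) / lam) :
    0 < lam ∧
    (coercivityClass N B t₀ T τ x₀ C).Nonempty ∧
    (∀ (y : Euc d) (u : Control k t₀ T),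
      MemLp (minControl N B t₀ T τ x₀ y u) ∞ (timeMeasure t₀ T)) ∧
    (∀ y : Euc d, ∃ L : ℝ≥0, 0 < L ∧
      LipschitzOnWith L (gramian N B t₀ T τ x₀) {u | ‖u‖ ≤ controlRadius B t₀ T Λ₁ C y}) ∧
    (∀ (y : Euc d) (L : ℝ≥0), 0 < L →
      LipschitzOnWith L (gramian N B t₀ T τ x₀) {u | ‖u‖ ≤ controlRadius B t₀ T Λ₁ C y} →
      ‖y‖ ≤ θ * lam ^ 2 /
        ((1 + θ) ^ 2 * L * inputNorm B t₀ T * Real.exp (Λ₁ * (T - t₀))) →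
      Set.MapsTo (synthesis N B t₀ T τ x₀ y)
        (feasibilityBall N B t₀ T τ Λ₁ x₀ C y) (feasibilityBall N B t₀ T τ Λ₁ x₀ C y) ∧
      (∃ u ∈ feasibilityBall N B t₀ T τ Λ₁ x₀ C y, synthesis N B t₀ T τ x₀ y u = u) ∧
      (∀ u ∈ feasibilityBall N B t₀ T τ Λ₁ x₀ C y, synthesis N B t₀ T τ x₀ y u = u →
        ∫ t in t₀..T, ‖u t‖ ^ 2 ≤ (1 + θ) / lam * ‖y‖ ^ 2)) := by
  have hτI : τ ∈ Icc t₀ T := by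
    rw [hτ]
    fin_cases i
    · exact left_mem_Icc.2 hT.le
    · exact right_mem_Icc.2 hT.le
  have hlam0 : 0 < lam := by
    rw [hlam]; exact lambdaMin_zeroGramian_pos hd hN hB hT hτI x₀ hW
  have hθ0 : 0 < θ := hθ.1
  have hC0 : 0 < C := by rw [hC]; positivity
  have hκ : 0 ≤ kernelBound B t₀ T Λ₁ := kernelBound_nonneg
  refine ⟨hlam0, ⟨0, ?_⟩, fun y u => memLp_minControl hN hB hT hτI x₀ y u,
    fun y => exists_lipschitzOnWith_gramian hN hB hT hτI x₀ _, fun y L hL hLip hy => ?_⟩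
  · change C⁻¹ ≤ lambdaMin (zeroGramian N B t₀ T τ x₀)
    rw [← hlam, hC, inv_div, div_le_iff₀ (by positivity)]
    nlinarith
  have hrad : controlRadius B t₀ T Λ₁ C y = kernelBound B t₀ T Λ₁ * (C * ‖y‖) := by
    rw [controlRadius, kernelBound]; ring
  have hcoer : ∀ u : Control k t₀ T, ‖u‖ ≤ controlRadius B t₀ T Λ₁ C y →
      C⁻¹ ≤ lambdaMin (gramian N B t₀ T τ x₀ u) := fun u hu => by
    rw [hC] at hu hLip ⊢
    exact inv_le_lambdaMin_gramian hd hN hB hT hτI x₀ hθ0 hlam0 hlam hLip hy hu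
  have hform : ∀ u : Control k t₀ T, C⁻¹ ≤ lambdaMin (gramian N B t₀ T τ x₀ u) →
      ∀ v, C⁻¹ * ‖v‖ ^ 2 ≤ inner ℝ (gramian N B t₀ T τ x₀ u v) v := fun u hu v =>
    (mul_le_mul_of_nonneg_right hu (sq_nonneg _)).trans
      ((hasEigenvalue_lambdaMin hd (isSymmetric_gramian hN hB hT hτI x₀ u)).2 v)
  -- No condition is imposed on u: the norm of w comes from the kernel bound, and coercivity at w
  -- from that norm. The same statement serves for the image of `synthesis` and, with u = w, for the
  -- feedback controls.
  have hball : ∀ (u w : Control k t₀ T) (p : Euc d), ‖p‖ ≤ C * ‖y‖ →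
      (∀ᵐ t ∂timeMeasure t₀ T,
        w t = ContinuousLinearMap.adjoint (inputKernel N B t₀ T τ x₀ u t) p) →
      w ∈ feasibilityBall N B t₀ T τ Λ₁ x₀ C y := fun u w p hp hw => by
    have h1 : ‖w‖ ≤ controlRadius B t₀ T Λ₁ C y := by
      rw [hrad]
      refine Control.norm_le_of_ae_norm_le (by positivity) ?_
      filter_upwards [hw, ae_norm_inputKernel_le hN hB hτI x₀ u] with t ht1 ht2
      rw [ht1]
      exact (ContinuousLinearMap.le_of_opNorm_le _ (norm_adjoint _).le p).trans (by gcongr)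
    exact ⟨hcoer w h1, h1⟩
  refine ⟨fun u hu => ?_, ?_, fun u hu hfix => ?_⟩
  · exact hball u _ _ ((apply_pinv_of_coercive hC0 (hform u hu.1)).2.2 y)
      (synthesis_ae_eq hN hB hT hτI x₀ y u)
  · obtain ⟨U, hU, hUlip⟩ := exists_feedback_control (k := k) hN hB hT hτI x₀
    have hmem : ∀ p, ‖p‖ ≤ C * ‖y‖ → U p ∈ feasibilityBall N B t₀ T τ Λ₁ x₀ C y := fun p hp =>
      hball (U p) (U p) p hp (hU p)
    set G : Euc d → Euc d := fun p => pinv (gramian N B t₀ T τ x₀ (U p)) y with hG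
    -- The multiplier ball has radius C|y|, the bound on 𝒩(u)† y under coercivity 1/C; the map G
    -- sends this ball to itself.
    have hR : 0 ≤ C * ‖y‖ := by positivity
    obtain ⟨c, hc0, hc⟩ := hUlip _ hR
    have hGcont : ContinuousOn G (Metric.closedBall 0 (C * ‖y‖)) := by
      refine (LipschitzOnWith.of_dist_le_mul
        (K := Real.toNNReal (C * (L * c * (C * ‖y‖)))) fun p hp q hq => ?_).continuousOn
      rw [mem_closedBall_zero_iff] at hp hq
      rw [dist_eq_norm, dist_eq_norm, Real.coe_toNNReal _ (by positivity)]
      have h1 := norm_pinv_apply_sub_le hC0 (hform _ (hmem p hp).1) (hform _ (hmem q hq).1) y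
      have h2 := hLip.norm_sub_le (hmem p hp).2 (hmem q hq).2
      calc ‖G p - G q‖ ≤ C * (L * (c * ‖p - q‖) * (C * ‖y‖)) := by
            refine h1.trans ?_
            gcongr
            exact h2.trans (by gcongr; exact hc p q hp hq)
        _ = _ := by ring
    obtain ⟨p, hp, hfix⟩ := exists_fixedPoint_of_continuousOn_closedBall hR hGcont
      (fun p hp => by
        rw [mem_closedBall_zero_iff] at hp ⊢
        exact (apply_pinv_of_coercive hC0 (hform _ (hmem p hp).1)).2.2 y)
    rw [mem_closedBall_zero_iff] at hp
    refine ⟨U p, hmem p hp, Lp.ext ?_⟩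
    filter_upwards [synthesis_ae_eq hN hB hT hτI x₀ y (U p), hU p] with t h1 h2
    rw [h1, h2, minControl]
    -- Here U(p) is the kernel adjoint applied to p, `synthesis` is the same adjoint applied to
    -- G(p), and G(p) = p.
    exact congrArg _ hfix
  · obtain ⟨h1, -, h3⟩ := apply_pinv_of_coercive hC0 (hform u hu.1)
    -- At a fixed point u = K_uᵀ p with 𝒩(u)p = y, so the energy is the quadratic form of the
    -- Gramian at p.
    have h4 : ∫ t in t₀..T, ‖u t‖ ^ 2 = inner ℝ y (pinv (gramian N B t₀ T τ x₀ u) y) := by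
      have h5 := inner_gramian_apply_self hN hB hT hτI x₀ u (pinv (gramian N B t₀ T τ x₀ u) y)
      rw [h1] at h5
      rw [h5]
      refine intervalIntegral.integral_congr_ae ?_
      rw [← ae_restrict_iff' measurableSet_uIoc, uIoc_of_le hT.le]
      have h6 := synthesis_ae_eq hN hB hT hτI x₀ y u
      rw [hfix] at h6
      filter_upwards [h6] with t ht
      rw [ht, minControl]
    rw [h4, ← hC]
    calc _ ≤ ‖y‖ * (C * ‖y‖) := (real_inner_le_norm _ _).trans (by gcongr; exact h3 y)
      _ = _ := by ring
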